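/- Let $N\ge 2$, $X=(x_1,\dots,x_N)\in\mathbb R^{3N}$, and let $$g(X)=\sum_{1\le i<j\le N}\frac1{|x_i-x_j|}.$$ Let $\|f\|^2=\int_{\mathbb R^{3N}} g(X)^2|f(X)|^2\,dX$ denote the norm of $L^2(\mathbb R^{3N},g(X)^2dX)$ (complex-valued functions). Let $H^1(\mathbb R^{3N},g(X)^2dX)$ be the space of those $f\in L^2(\mathbb R^{3N},g(X)^2dX)$ whose weak gradients $\nabla_i f$ with respect to $x_i\in\mathbb R^3$, $1\le i\le N$, all lie in $L^2(\mathbb R^{3N},g(X)^2dX)$. For $q\in\mathbb N$ let $\mathcal A_q^N$ be the set of $f\in L^2(\mathbb R^{3N},g(X)^2dX)$ for which there is a partition of $\{1,\dots,N\}$ into $q$ disjoint (possibly empty) subsets such that $f$ is antisymmetric in the variables corresponding to each subset. The density of $f$ is $$\rho_f(x)=\sum_{i=1}^N\int_{\mathbb R^{3(N-1)}} g(\hat X_i)^2|f(\hat X_i)|^2\,d\hat X_i,\qquad \hat X_i=(x_1,\dots,x_{i-1},x,x_{i+1},\dots,x_N),\quad d\hat X_i=\prod_{j\ne i}dx_j,$$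 which is a function in $L^1(\mathbb R^3)$. **Proposition (local exclusion principle).** There is a universal constant $k>0$ (in particular independent of $N$, $q$, $f$, $L$ and of the location and orientation of the cube) such that for all $N\ge2$, all $q$, all $f\in H^1(\mathbb R^{3N},g(X)^2dX)\cap\mathcal A_q^N$ with $\|f\|=1$, and every cube $\mathcal C_L\subset\mathbb R^3$ of side length $L>0$, $$\sum_{i=1}^N\int_{\mathbb R^{3N}} g(X)^2\,|\nabla_i f(X)|^2\,\chi_{\mathcal C_L}(x_i)\,dX\;\ge\;\frac{k}{L^2}\left(\int_{\mathcal C_L}\rho_f(x)\,dx-q\right),$$ where $\chi_{\mathcal C_L}$ is the characteristic function of $\mathcal C_L$. -/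

import Mathlib

open MeasureTheory
open scoped ContDiff

namespace PointInteraction

/-- Three-dimensional Euclidean space. -/
abbrev Space : Type := EuclideanSpace ℝ (Fin 3)

/-- Configurations `X = (x₁, …, x_N)` of `N` particles. The measure `volume` on this type is the
product of the Lebesgue measures, i.e. `dX`. -/
abbrev Config (N : ℕ) : Type := Fin N → Space

/-- The function `g(X) = ∑_{i<j} 1 / |x_i - x_j|`. (On the Lebesgue null set where two particles
coincide the corresponding summand has the value `0` here, which is immaterial.) -/
noncomputable def g {N : ℕ} (X : Config N) : ℝ :=
  ∑ i : Fin N, ∑ j ∈ Finset.Ioi i, 1 / ‖X i - X j‖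

/-- The measure `g(X)² dX`. -/
noncomputable def weightedMeasure (N : ℕ) : Measure (Config N) :=
  (volume : Measure (Config N)).withDensity (fun X => ENNReal.ofReal (g X ^ 2))

/-- `G i X = ∇_i f (X)` in the sense of weak derivatives on `ℝ^{3N}` (with respect to `dX`):
`∫ (∂φ/∂x_{i,a}) f dX = - ∫ φ (G i)_a dX` for all `φ ∈ C_c^∞(ℝ^{3N})`. -/
def IsWeakGradient {N : ℕ} (f : Config N → ℂ)
    (G : Fin N → Config N → EuclideanSpace ℂ (Fin 3)) : Prop :=
  LocallyIntegrable f volume ∧ (∀ i, LocallyIntegrable (G i) volume) ∧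
    ∀ (i : Fin N) (a : Fin 3) (φ : Config N → ℝ), ContDiff ℝ ∞ φ → HasCompactSupport φ →
      ∫ X, (fderiv ℝ φ X (Pi.single i (EuclideanSpace.single a 1))) • f X
        = - ∫ X, φ X • (G i X) a

/-- `f` belongs to the weighted Sobolev space `H¹(ℝ^{3N}, g(X)² dX)` and its weak gradients with
respect to the particle positions are `∇_i f = G i`. -/
structure IsH1WithGradient {N : ℕ} (f : Config N → ℂ)
    (G : Fin N → Config N → EuclideanSpace ℂ (Fin 3)) : Prop where
  memLp : MemLp f 2 (weightedMeasure N)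
  isWeakGradient : IsWeakGradient f G
  memLp_gradient : ∀ i, MemLp (G i) 2 (weightedMeasure N)

/-- The symmetry condition defining `A_q^N`: the particle labels can be divided into `q` disjoint
(possibly empty) classes, the fibres of `c`, such that `f` is antisymmetric in the variables of
each class. -/
def IsAntisymmetricInClasses {N : ℕ} (q : ℕ) (f : Config N → ℂ) : Prop :=
  ∃ c : Fin N → Fin q, ∀ i j : Fin N, i ≠ j → c i = c j →
    ∀ᵐ X : Config N, f (X ∘ Equiv.swap i j) = - f X

/-- The configuration whose `i`-th particle is at `x`, all others being at the positions `Y`. -/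
def insertAt {N : ℕ} (i : Fin N) (x : Space) (Y : {j : Fin N // j ≠ i} → Space) : Config N :=
  fun j => if h : j = i then x else Y ⟨j, h⟩

/-- The one-particle density
`ρ_f(x) = ∑_i ∫ g(X̂_i)² |f(X̂_i)|² ∏_{j ≠ i} dx_j`, where `X̂_i` has `x` in position `i`. -/
noncomputable def density {N : ℕ} (f : Config N → ℂ) (x : Space) : ℝ :=
  ∑ i : Fin N, ∫ Y : {j : Fin N // j ≠ i} → Space,
    g (insertAt i x Y) ^ 2 * ‖f (insertAt i x Y)‖ ^ 2

/-- `C` is a cube in `ℝ³` of side length `L`, of arbitrary location and orientation, and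
containing an arbitrary part of its boundary. -/
def IsCube (C : Set Space) (L : ℝ) : Prop :=
  ∃ e : Space ≃ᵢ Space, e '' {x | ∀ a, 0 < x a ∧ x a < L} ⊆ C ∧
    C ⊆ e '' {x | ∀ a, 0 ≤ x a ∧ x a ≤ L}

end PointInteraction

/-!
The theorem reduces to a statement about two particles. For a configuration let `A` be the set of
particles in the cube. The configurations with a given `A` are treated separately. Suppose that,
on them, every two distinct particles `i`, `j` of `A` in the same class satisfy the pair inequality
`∫ g² |f|² ≤ K L² ∫ g² (|∇_i f|² + |∇_j f|²)`. Then each class contains at most one particle of `A`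
whose energy `∫ g² |∇_i f|²` is less than `(2 K L²)⁻¹ ∫ g² |f|²`, so that the total energy of the
particles of `A` is at least `(|A| - q) (2 K L²)⁻¹ ∫ g² |f|²` (`card_sub_mul_le`). Summation over
`A` gives the claim, because `∑_A |A| ∫_A g² |f|²` is the integral of the density over the cube.

The pair inequality (`lintegral_occupation_le`) is a Poincaré inequality on the square of the cube
with the weight `g²`, all other particles being fixed. As `f` is antisymmetric in `x_i`, `x_j`, it is
bounded by its oscillation: `2 f X = (f X - f Z) - (f X' - f Z)`, where `X'` is `X` with the two
positions exchanged and `Z` is any configuration that arises from `X` by a motion of the two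
particles (`enorm_sq_le_pairOscillation`). The difference `f X - f Z` is the integral of the
gradient over the segment from `X` to `Z`; for a weakly differentiable function this holds for
almost every `X` when `Z - X` is fixed (`ae_sub_eq_integral_of_weak_deriv`), and is proved by
testing against smooth functions. When the point `P` of the segment is made the variable of
integration, the weight `g² X` is averaged over motions `X = P - t d` of the two particles. It
remains to bound this average by a multiple of `g² P` which depends neither on the number nor on
the positions of the other particles (`lintegral_g_sq_sub_pairShift_le`). By the Cauchy–Schwarz
inequality that follows from the same property of each term `|x_k - x_l|⁻²`, which holds because
`|x|⁻²` is a Muckenhoupt `A₁` weight on `ℝ³` (`lintegral_inv_sq_perturb_le`).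
-/

namespace PointInteraction

open Set Metric

/-! ### Weak directional derivatives and segments -/

/-- The union of the translates of `K` by the points of the segment from `0` to `v`. -/
def sweep {E : Type*} [NormedAddCommGroup E] [NormedSpace ℝ E] (K : Set E) (v : E) : Set E :=
  (fun p : E × ℝ => p.1 + p.2 • v) '' (K ×ˢ Icc 0 1)

lemma isCompact_sweep {E : Type*} [NormedAddCommGroup E] [NormedSpace ℝ E] {K : Set E}
    (hK : IsCompact K) (v : E) : IsCompact (sweep K v) :=
  (hK.prod isCompact_Icc).image (by fun_prop)

lemma add_smul_mem_sweep {E : Type*} [NormedAddCommGroup E] [NormedSpace ℝ E] {K : Set E}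
    {v x : E} {t : ℝ} (hx : x ∈ K) (ht : t ∈ Ioc (0 : ℝ) 1) :
    x + t • v ∈ sweep K v :=
  ⟨(x, t), ⟨hx, ht.1.le, ht.2⟩, rfl⟩

section WeakDerivative

variable {E F : Type*} [NormedAddCommGroup E] [NormedSpace ℝ E] [FiniteDimensional ℝ E]
  [MeasurableSpace E] [BorelSpace E] [NormedAddCommGroup F]
  {μ : Measure E} [μ.IsAddHaarMeasure]

lemma integrable_comp_add_smul {g : E → F} (hg : StronglyMeasurable g)
    (hloc : LocallyIntegrable g μ) {K : Set E} (hK : IsCompact K) (v : E) :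
    Integrable (fun p : E × ℝ => g (p.1 + p.2 • v))
      ((μ.restrict K).prod (volume.restrict (Ioc (0 : ℝ) 1))) := by
  have hm : StronglyMeasurable (fun p : E × ℝ => g (p.1 + p.2 • v)) :=
    hg.comp_measurable (by fun_prop)
  refine ⟨hm.aestronglyMeasurable, ?_⟩
  have hK' := isCompact_sweep hK v
  have hfin : ∫⁻ x in sweep K v, ‖g x‖ₑ ∂μ < ⊤ := (hloc.integrableOn_isCompact hK').2
  rw [HasFiniteIntegral, lintegral_prod_symm _ hm.enorm.aemeasurable]
  have hb : ∀ t ∈ Ioc (0 : ℝ) 1,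
      ∫⁻ x in K, ‖g (x + t • v)‖ₑ ∂μ ≤ ∫⁻ x in sweep K v, ‖g x‖ₑ ∂μ := by
    intro t ht
    rw [← lintegral_indicator hK.measurableSet, ← lintegral_indicator hK'.measurableSet,
      ← lintegral_add_right_eq_self ((sweep K v).indicator fun x => ‖g x‖ₑ) (t • v)]
    refine lintegral_mono fun x => ?_
    by_cases hx : x ∈ K
    · rw [indicator_of_mem hx, indicator_of_mem (add_smul_mem_sweep hx ht)]
    · rw [indicator_of_notMem hx]; exact zero_le
  calc _ ≤ ∫⁻ _ in Ioc (0 : ℝ) 1, ∫⁻ x in sweep K v, ‖g x‖ₑ ∂μ :=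
        setLIntegral_mono measurable_const hb
    _ < ⊤ := by simpa using hfin

lemma locallyIntegrable_integral_add_smul [NormedSpace ℝ F] [CompleteSpace F]
    {g : E → F} (hg : StronglyMeasurable g)
    (hloc : LocallyIntegrable g μ) (v : E) :
    LocallyIntegrable (fun x => ∫ t in Ioc (0 : ℝ) 1, g (x + t • v)) μ :=
  locallyIntegrable_iff.2 fun _ hK =>
    (integrable_comp_add_smul hg hloc hK v).integral_prod_left

/-- A locally integrable function `f` whose weak derivative in the direction `v` is `g` satisfies
the fundamental theorem of calculus along almost every segment parallel to `v`: tested against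
`φ`, both sides equal `∫ (φ (x - v) - φ x) f x`. -/
theorem ae_sub_eq_integral_of_weak_deriv [NormedSpace ℝ F] [CompleteSpace F]
    {f g : E → F}
    (hf : LocallyIntegrable f μ) (hg : StronglyMeasurable g) (hgloc : LocallyIntegrable g μ)
    (v : E)
    (hweak : ∀ φ : E → ℝ, ContDiff ℝ ∞ φ → HasCompactSupport φ →
      ∫ x, fderiv ℝ φ x v • f x ∂μ = - ∫ x, φ x • g x ∂μ) :
    ∀ᵐ x ∂μ, f (x + v) - f x = ∫ t in Ioc (0 : ℝ) 1, g (x + t • v) := by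
  have hfv : LocallyIntegrable (fun x => f (x + v)) μ := by
    refine locallyIntegrable_iff.2 fun K hK => ?_
    have h1 := hf.integrableOn_isCompact (hK.image (continuous_add_const v))
    have h2 := (measurePreserving_add_right μ v).integrableOn_comp_preimage
      (measurableEmbedding_addRight v) (f := f) (s := (fun x => x + v) '' K)
    have h3 := h2.2 h1
    rwa [preimage_image_eq _ (add_left_injective v)] at h3
  refine ae_eq_of_integral_contDiff_smul_eq (hfv.sub hf)
    (locallyIntegrable_integral_add_smul hg hgloc v) fun φ hφ hφc => ?_
  set I : Set ℝ := Ioc (0 : ℝ) 1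
  -- the derivative of `φ` along the segment, integrated against `f`
  have hφ1 : Continuous fun x => fderiv ℝ φ x v :=
    (hφ.continuous_fderiv (by simp)).clm_apply continuous_const
  have hφt : ∀ t : ℝ, ContDiff ℝ ∞ (fun x => φ (x - t • v)) := fun t =>
    hφ.comp (contDiff_id.sub contDiff_const)
  have hφtc : ∀ t : ℝ, HasCompactSupport (fun x => φ (x - t • v)) := fun t => by
    have := hφc.comp_homeomorph (Homeomorph.addRight (-(t • v)))
    simpa [sub_eq_add_neg, Function.comp_def] using this
  have hφtd : ∀ (t : ℝ) x, fderiv ℝ (fun x => φ (x - t • v)) x v = fderiv ℝ φ (x - t • v) v := by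
    intro t x
    rw [fderiv_comp_sub]
  have hftc : ∀ x, ∫ t in I, fderiv ℝ φ (x - t • v) v = φ x - φ (x - v) := by
    intro x
    have hd : ∀ t : ℝ, HasDerivAt (fun t : ℝ => - φ (x - t • v)) (fderiv ℝ φ (x - t • v) v) t := by
      intro t
      have h1 : HasDerivAt (fun t : ℝ => x - t • v) (-v) t := by
        simpa using ((hasDerivAt_id t).smul_const v).const_sub x
      have h2 := ((hφ.differentiable (by simp)) (x - t • v)).hasFDerivAt.comp_hasDerivAt t h1
      simpa [Function.comp_def] using h2.fun_neg
    have h3 := intervalIntegral.integral_eq_sub_of_hasDerivAt (a := 0) (b := 1)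
      (fun t _ => hd t) (Continuous.intervalIntegrable (hφ1.comp (by fun_prop)) _ _)
    rw [intervalIntegral.integral_of_le zero_le_one] at h3
    rw [h3]; simp; ring
  obtain ⟨C, hC⟩ := hφc.exists_bound_of_continuous hφ.continuous
  have hφ'c : HasCompactSupport fun x => fderiv ℝ φ x v :=
    hφc.fderiv_apply (𝕜 := ℝ) v
  obtain ⟨C', hC'⟩ := hφ'c.exists_bound_of_continuous hφ1
  set K := tsupport φ with hKdef
  have hK : IsCompact K := hφc
  -- integrability needed to exchange the integrals over `x` and over the segment
  have hint1 : Integrable (Function.uncurry fun (x : E) (t : ℝ) => φ x • g (x + t • v))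
      (μ.prod (volume.restrict I)) := by
    have h1 := (integrable_comp_add_smul hg hgloc hK v).bdd_smul (φ := fun p : E × ℝ => φ p.1) C
      (by have := hφ.continuous; exact (this.comp continuous_fst).aestronglyMeasurable)
      (Filter.Eventually.of_forall fun p => hC p.1)
    have h2 : (μ.restrict K).prod (volume.restrict I)
        = (μ.prod (volume.restrict I)).restrict (K ×ˢ univ) := by
      rw [← Measure.prod_restrict, Measure.restrict_univ]
    rw [h2] at h1
    refine (integrableOn_iff_integrable_of_support_subset ?_).1 h1
    intro p hp
    refine ⟨?_, mem_univ _⟩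
    by_contra h
    exact hp (by simp [Function.uncurry, image_eq_zero_of_notMem_tsupport h])
  have hint2 : Integrable (Function.uncurry fun (x : E) (t : ℝ) => fderiv ℝ φ (x - t • v) v • f x)
      (μ.prod (volume.restrict I)) := by
    have hK' := isCompact_sweep hK v
    have h0 : Integrable (fun p : E × ℝ => f p.1)
        ((μ.restrict (sweep K v)).prod (volume.restrict I)) :=
      Integrable.comp_fst (hf.integrableOn_isCompact hK') _
    have h1 := h0.bdd_smul (φ := fun p : E × ℝ => fderiv ℝ φ (p.1 - p.2 • v) v) C'
      (hφ1.comp (by fun_prop : Continuous fun p : E × ℝ => p.1 - p.2 • v)).aestronglyMeasurable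
      (Filter.Eventually.of_forall fun p => hC' _)
    have h2 : (μ.restrict (sweep K v)).prod (volume.restrict I)
        = (μ.prod volume).restrict ((sweep K v) ×ˢ I) := by
      rw [← Measure.prod_restrict]
    have h3 : μ.prod (volume.restrict I) = (μ.prod volume).restrict (univ ×ˢ I) := by
      rw [← Measure.prod_restrict, Measure.restrict_univ]
    rw [h2] at h1
    rw [h3]
    refine IntegrableOn.of_forall_sdiff_eq_zero (t := univ ×ˢ I) h1
      (MeasurableSet.univ.prod measurableSet_Ioc) ?_
    rintro ⟨x, t⟩ ⟨⟨-, ht⟩, hn⟩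
    have : x - t • v ∉ K := fun h => hn ⟨by simpa using add_smul_mem_sweep (v := v) h ht, ht⟩
    have h4 : fderiv ℝ φ (x - t • v) = 0 :=
      image_eq_zero_of_notMem_tsupport fun h => this (tsupport_fderiv_subset ℝ h)
    simp [Function.uncurry, h4]
  have hif : ∀ t : ℝ, Integrable (fun x => φ (x - t • v) • f x) μ := fun t =>
    hf.integrable_smul_left_of_hasCompactSupport (hφt t).continuous (hφtc t)
  have hif0 : Integrable (fun x => φ x • f x) μ := by simpa using hif 0
  have hifv : Integrable (fun x => φ x • f (x + v)) μ :=
    hfv.integrable_smul_left_of_hasCompactSupport hφ.continuous hφc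
  have hif1 : Integrable (fun x => φ (x - v) • f x) μ := by simpa using hif 1
  symm
  calc ∫ x, φ x • (∫ t in I, g (x + t • v)) ∂μ
      = ∫ x, (∫ t in I, φ x • g (x + t • v)) ∂μ := by simp_rw [integral_smul]
    _ = ∫ t in I, ∫ x, φ x • g (x + t • v) ∂μ := integral_integral_swap hint1
    _ = ∫ t in I, ∫ x, φ (x - t • v) • g x ∂μ := by
        congr 1; ext t
        rw [← integral_sub_right_eq_self (fun x => φ x • g (x + t • v)) (t • v)]
        simp
    _ = ∫ t in I, - ∫ x, fderiv ℝ φ (x - t • v) v • f x ∂μ := by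
        congr 1; ext t
        have := hweak _ (hφt t) (hφtc t)
        simp_rw [hφtd] at this
        rw [this, neg_neg]
    _ = - ∫ x, (∫ t in I, fderiv ℝ φ (x - t • v) v • f x) ∂μ := by
        rw [integral_neg, integral_integral_swap hint2]
    _ = - ∫ x, (φ x • f x - φ (x - v) • f x) ∂μ := by
        simp_rw [integral_smul_const, hftc, sub_smul]
    _ = ∫ x, φ x • f (x + v) ∂μ - ∫ x, φ x • f x ∂μ := by
        have h := integral_sub_right_eq_self (μ := μ) (fun x => φ x • f (x + v)) v
        simp only [sub_add_cancel] at h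
        rw [integral_sub hif0 hif1, h, neg_sub]
    _ = ∫ x, φ x • (f (x + v) - f x) ∂μ := by
        rw [← integral_sub hifv hif0]
        simp_rw [smul_sub]

end WeakDerivative

/-! ### Averages of the weight -/

/-- The volume of the unit ball of `ℝ³`. -/
noncomputable def unitBallVolume : ℝ := (volume : Measure Space).real (ball 0 1)

lemma unitBallVolume_pos : 0 < unitBallVolume :=
  ENNReal.toReal_pos (measure_ball_pos _ _ one_pos).ne' measure_ball_lt_top.ne

lemma volume_ball_eq (c : Space) {r : ℝ} (hr : 0 ≤ r) :
    volume (ball c r) = ENNReal.ofReal (r ^ 3 * unitBallVolume) := by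
  rw [Measure.addHaar_ball _ _ hr, ENNReal.ofReal_mul (by positivity), unitBallVolume,
    ofReal_measureReal]
  simp

lemma volume_closedBall_eq (c : Space) {r : ℝ} (hr : 0 ≤ r) :
    volume (closedBall c r) = ENNReal.ofReal (r ^ 3 * unitBallVolume) := by
  rw [Measure.addHaar_closedBall_eq_addHaar_ball, volume_ball_eq c hr]

lemma lintegral_ball_inv_sq {r : ℝ} (hr : 0 < r) :
    ∫⁻ d in ball (0 : Space) r, ENNReal.ofReal (‖d‖ ^ 2)⁻¹
      = ENNReal.ofReal (3 * unitBallVolume * r) := by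
  set ψ : ℝ → ℝ := (Iio r).indicator fun y => (y ^ 2)⁻¹ with hψ
  have hprod : EqOn (fun y : ℝ => y ^ (Module.finrank ℝ Space - 1) • ψ y)
      ((Iio r).indicator fun _ => 1) (Ioi 0) := by
    intro y hy
    have hy : (0 : ℝ) < y := hy
    by_cases h : y < r
    · simp [hψ, indicator_of_mem (show y ∈ Iio r from h), hy.ne']
    · simp [hψ, indicator_of_notMem (show y ∉ Iio r from h)]
  have hint : IntegrableOn (fun y : ℝ => y ^ (Module.finrank ℝ Space - 1) • ψ y) (Ioi 0) := by
    rw [integrableOn_congr_fun hprod measurableSet_Ioi, IntegrableOn,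
      integrable_indicator_iff measurableSet_Iio, IntegrableOn,
      Measure.restrict_restrict measurableSet_Iio]
    refine integrableOn_const ?_
    rw [inter_comm, Ioi_inter_Iio]
    simp
  have hψint : Integrable (fun d : Space => ψ ‖d‖) :=
    (integrable_fun_norm_addHaar volume).2 hint
  have hval : ∫ d : Space, ψ ‖d‖ = 3 * unitBallVolume * r := by
    rw [integral_fun_norm_addHaar, setIntegral_congr_fun measurableSet_Ioi hprod,
      setIntegral_indicator measurableSet_Iio, Ioi_inter_Iio, setIntegral_const]
    simp [hr.le, unitBallVolume]
    ring
  rw [← lintegral_indicator measurableSet_ball, ← hval,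
    ofReal_integral_eq_lintegral_ofReal hψint]
  · refine lintegral_congr fun d => ?_
    by_cases h : ‖d‖ < r
    · rw [indicator_of_mem (by simpa using h)]
      simp [hψ, indicator_of_mem (show ‖d‖ ∈ Iio r from h)]
    · rw [indicator_of_notMem (by simpa using h)]
      simp [hψ, indicator_of_notMem (show ‖d‖ ∉ Iio r from h)]
  · refine Filter.Eventually.of_forall fun d => ?_
    exact indicator_nonneg (fun y _ => by positivity) _

lemma lintegral_closedBall_inv_sq_le (c : Space) {r : ℝ} (hr : 0 < r) :
    ∫⁻ d in closedBall (0 : Space) r, ENNReal.ofReal (‖c - d‖ ^ 2)⁻¹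
      ≤ ENNReal.ofReal (4 * unitBallVolume * r) := by
  have hpt : ∀ d, ENNReal.ofReal (‖c - d‖ ^ 2)⁻¹ ≤
      (ball (0 : Space) r).indicator (fun d => ENNReal.ofReal (‖d‖ ^ 2)⁻¹) (c - d)
        + ENNReal.ofReal (r ^ 2)⁻¹ := by
    intro d
    by_cases h : ‖c - d‖ < r
    · rw [indicator_of_mem (by simpa using h)]
      exact le_self_add
    · refine le_add_left (ENNReal.ofReal_le_ofReal ?_)
      have : r ≤ ‖c - d‖ := not_lt.1 h
      gcongr
  have hm : Measurable fun d : Space => ENNReal.ofReal (‖d‖ ^ 2)⁻¹ := by fun_prop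
  have hV := unitBallVolume_pos
  calc _ ≤ ∫⁻ d in closedBall (0 : Space) r,
        ((ball (0 : Space) r).indicator (fun d => ENNReal.ofReal (‖d‖ ^ 2)⁻¹) (c - d)
          + ENNReal.ofReal (r ^ 2)⁻¹) := lintegral_mono hpt
    _ = (∫⁻ d in closedBall (0 : Space) r,
        (ball (0 : Space) r).indicator (fun d => ENNReal.ofReal (‖d‖ ^ 2)⁻¹) (c - d))
          + ENNReal.ofReal (r ^ 2)⁻¹ * ENNReal.ofReal (r ^ 3 * unitBallVolume) := by
        rw [lintegral_add_right _ measurable_const, setLIntegral_const,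
          volume_closedBall_eq _ hr.le]
    _ ≤ (∫⁻ d : Space,
        (ball (0 : Space) r).indicator (fun d => ENNReal.ofReal (‖d‖ ^ 2)⁻¹) (c - d))
          + ENNReal.ofReal (r ^ 2)⁻¹ * ENNReal.ofReal (r ^ 3 * unitBallVolume) := by
        gcongr
        exact Measure.restrict_le_self
    _ = ENNReal.ofReal (4 * unitBallVolume * r) := by
        rw [lintegral_sub_left_eq_self, lintegral_indicator measurableSet_ball,
          lintegral_ball_inv_sq hr, ← ENNReal.ofReal_mul (by positivity),
          ← ENNReal.ofReal_add (by positivity) (by positivity)]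
        congr 1
        field_simp
        norm_num

/-- `d ↦ |v - d|⁻²` is a Muckenhoupt `A₁` weight: when `v` is moved by a vector of length at most
`2 t r` the average of the weight over this motion is at most a multiple of its value at `v`.
The perturbation is negligible unless `4 t r > |v|`, and in that case the integral of `|x|⁻²` over
a ball of radius `t r` is of the right size. -/
lemma lintegral_inv_sq_perturb_le {v w : Space} (hv : v ≠ 0) {r t : ℝ} (hr : 0 < r) (ht : 0 ≤ t)
    (hw : ‖w‖ ≤ t * r) :
    ∫⁻ d in closedBall (0 : Space) r, ENNReal.ofReal (‖v + w - t • d‖ ^ 2)⁻¹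
      ≤ ENNReal.ofReal (64 * unitBallVolume * r ^ 3 * (‖v‖ ^ 2)⁻¹) := by
  have hV := unitBallVolume_pos
  have hv' : 0 < ‖v‖ := norm_pos_iff.2 hv
  by_cases h : 4 * (t * r) ≤ ‖v‖
  · calc _ ≤ ∫⁻ _ in closedBall (0 : Space) r, ENNReal.ofReal (4 * (‖v‖ ^ 2)⁻¹) := by
          refine setLIntegral_mono measurable_const fun d hd => ENNReal.ofReal_le_ofReal ?_
          have hd' : ‖t • d‖ ≤ t * r := by
            rw [norm_smul, Real.norm_of_nonneg ht]
            exact mul_le_mul_of_nonneg_left (by simpa using hd) ht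
          have h1 : ‖v‖ ≤ ‖v + w - t • d‖ + (‖w‖ + ‖t • d‖) := by
            calc ‖v‖ = ‖(v + w - t • d) + (t • d - w)‖ := by congr 1; abel
              _ ≤ ‖v + w - t • d‖ + ‖t • d - w‖ := norm_add_le _ _
              _ ≤ _ := by
                have := norm_sub_le (t • d) w
                linarith
          have h2 : ‖v‖ / 2 ≤ ‖v + w - t • d‖ := by linarith
          calc (‖v + w - t • d‖ ^ 2)⁻¹ ≤ ((‖v‖ / 2) ^ 2)⁻¹ := by gcongr
            _ = 4 * (‖v‖ ^ 2)⁻¹ := by field_simp; norm_num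
      _ = ENNReal.ofReal (4 * (‖v‖ ^ 2)⁻¹ * (r ^ 3 * unitBallVolume)) := by
          rw [setLIntegral_const, volume_closedBall_eq _ hr.le, ← ENNReal.ofReal_mul (by positivity)]
      _ ≤ _ := by
          refine ENNReal.ofReal_le_ofReal ?_
          have : 0 ≤ (‖v‖ ^ 2)⁻¹ * (r ^ 3 * unitBallVolume) := by positivity
          linarith
  · push Not at h
    have ht' : 0 < t := by
      rcases ht.eq_or_lt with rfl | h0
      · simp only [zero_mul, mul_zero] at h; exact absurd h hv'.not_gt
      · exact h0
    have hscale : ∀ d, ENNReal.ofReal (‖v + w - t • d‖ ^ 2)⁻¹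
        = ENNReal.ofReal (t ^ 2)⁻¹ * ENNReal.ofReal (‖t⁻¹ • (v + w) - d‖ ^ 2)⁻¹ := by
      intro d
      have : v + w - t • d = t • (t⁻¹ • (v + w) - d) := by
        rw [smul_sub, smul_inv_smul₀ ht'.ne']
      rw [this, norm_smul, Real.norm_of_nonneg ht, mul_pow, mul_inv,
        ENNReal.ofReal_mul (by positivity)]
    simp_rw [hscale]
    rw [lintegral_const_mul _ (by fun_prop)]
    calc _ ≤ ENNReal.ofReal (t ^ 2)⁻¹ * ENNReal.ofReal (4 * unitBallVolume * r) := by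
          gcongr; exact lintegral_closedBall_inv_sq_le _ hr
      _ = ENNReal.ofReal ((t ^ 2)⁻¹ * (4 * unitBallVolume * r)) :=
          (ENNReal.ofReal_mul (by positivity)).symm
      _ ≤ _ := by
          refine ENNReal.ofReal_le_ofReal ?_
          have h1 : (t ^ 2)⁻¹ ≤ 16 * r ^ 2 * (‖v‖ ^ 2)⁻¹ := by
            rw [inv_le_comm₀ (by positivity) (by positivity)]
            rw [mul_inv, inv_inv, inv_mul_le_iff₀ (by positivity)]
            nlinarith
          calc _ ≤ 16 * r ^ 2 * (‖v‖ ^ 2)⁻¹ * (4 * unitBallVolume * r) := by gcongr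
            _ = _ := by ring

/-- The pairs of displacements of length at most `r`, with Lebesgue measure. -/
noncomputable def displacementMeasure (r : ℝ) : Measure (Space × Space) :=
  (volume.restrict (closedBall 0 r)).prod (volume.restrict (closedBall 0 r))

/-- The configuration of displacements which moves the `i`-th particle by `d.1`, the `j`-th by
`d.2`, and no other. -/
def pairShift {N : ℕ} (i j : Fin N) (d : Space × Space) : Config N :=
  Pi.single i d.1 + Pi.single j d.2

section pairShift

variable {N : ℕ} {i j : Fin N}

lemma pairShift_apply_left (hij : i ≠ j) (d : Space × Space) : pairShift i j d i = d.1 := by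
  simp [pairShift, hij]

lemma pairShift_apply_right (hij : i ≠ j) (d : Space × Space) : pairShift i j d j = d.2 := by
  simp [pairShift, hij.symm]

lemma pairShift_apply_of_ne {k : Fin N} (hi : k ≠ i) (hj : k ≠ j) (d : Space × Space) :
    pairShift i j d k = 0 := by
  simp [pairShift, hi, hj]

lemma continuous_pairShift : Continuous (pairShift i j) := by
  refine continuous_pi fun k => ?_
  simp only [pairShift, Pi.add_apply, Pi.single_apply]
  split_ifs <;> fun_prop

lemma measurable_pairShift : Measurable (pairShift i j) := continuous_pairShift.measurable

end pairShift

section average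

variable {r t : ℝ} {v : Space}

lemma lintegral_displacement_sub_le (hv : v ≠ 0) (hr : 0 < r) (ht : 0 ≤ t) :
    ∫⁻ d, ENNReal.ofReal (‖v - t • (d.1 - d.2)‖ ^ 2)⁻¹ ∂displacementMeasure r
      ≤ ENNReal.ofReal (64 * unitBallVolume ^ 2 * r ^ 6 * (‖v‖ ^ 2)⁻¹) := by
  have hV := unitBallVolume_pos
  rw [displacementMeasure, lintegral_prod_symm' _ (by fun_prop)]
  calc _ ≤ ∫⁻ _ in closedBall (0 : Space) r,
        ENNReal.ofReal (64 * unitBallVolume * r ^ 3 * (‖v‖ ^ 2)⁻¹) := by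
        refine setLIntegral_mono measurable_const fun y hy => ?_
        have hy' : ‖t • y‖ ≤ t * r := by
          rw [norm_smul, Real.norm_of_nonneg ht]
          exact mul_le_mul_of_nonneg_left (by simpa using hy) ht
        refine le_trans (le_of_eq ?_) (lintegral_inv_sq_perturb_le hv hr ht hy')
        refine lintegral_congr fun x => ?_
        rw [show v - t • (x - y) = v + t • y - t • x by rw [smul_sub]; abel]
    _ = _ := by
        rw [setLIntegral_const, volume_closedBall_eq _ hr.le, ← ENNReal.ofReal_mul (by positivity)]
        congr 1; ring

lemma lintegral_displacement_fst_le (hv : v ≠ 0) (hr : 0 < r) (ht : 0 ≤ t) :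
    ∫⁻ d, ENNReal.ofReal (‖v - t • d.1‖ ^ 2)⁻¹ ∂displacementMeasure r
      ≤ ENNReal.ofReal (64 * unitBallVolume ^ 2 * r ^ 6 * (‖v‖ ^ 2)⁻¹) := by
  have hV := unitBallVolume_pos
  rw [displacementMeasure, lintegral_prod_symm' _ (by fun_prop)]
  have h := lintegral_inv_sq_perturb_le (w := 0) hv hr ht (by simpa using by positivity)
  simp only [add_zero] at h
  calc _ ≤ ∫⁻ _ in closedBall (0 : Space) r,
        ENNReal.ofReal (64 * unitBallVolume * r ^ 3 * (‖v‖ ^ 2)⁻¹) := lintegral_mono fun _ => h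
    _ = _ := by
        rw [setLIntegral_const, volume_closedBall_eq _ hr.le, ← ENNReal.ofReal_mul (by positivity)]
        congr 1; ring

lemma lintegral_displacement_snd_le (hv : v ≠ 0) (hr : 0 < r) (ht : 0 ≤ t) :
    ∫⁻ d, ENNReal.ofReal (‖v - t • d.2‖ ^ 2)⁻¹ ∂displacementMeasure r
      ≤ ENNReal.ofReal (64 * unitBallVolume ^ 2 * r ^ 6 * (‖v‖ ^ 2)⁻¹) := by
  refine le_trans (le_of_eq ?_) (lintegral_displacement_fst_le hv hr ht)
  rw [displacementMeasure, lintegral_prod_symm' _ (by fun_prop), lintegral_prod _ (by fun_prop)]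

lemma lintegral_displacement_const_le (hr : 0 < r) :
    ∫⁻ _, ENNReal.ofReal (‖v‖ ^ 2)⁻¹ ∂displacementMeasure r
      ≤ ENNReal.ofReal (64 * unitBallVolume ^ 2 * r ^ 6 * (‖v‖ ^ 2)⁻¹) := by
  have hV := unitBallVolume_pos
  rw [displacementMeasure, lintegral_const, Measure.prod_apply MeasurableSet.univ]
  simp only [preimage_univ, Measure.restrict_apply_univ, lintegral_const,
    volume_closedBall_eq (0 : Space) hr.le]
  rw [← ENNReal.ofReal_mul (by positivity), ← ENNReal.ofReal_mul (by positivity)]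
  refine ENNReal.ofReal_le_ofReal ?_
  have : 0 ≤ unitBallVolume ^ 2 * r ^ 6 * (‖v‖ ^ 2)⁻¹ := by positivity
  linarith

end average

lemma lintegral_pair_le {N : ℕ} {i j : Fin N} (hij : i ≠ j) {P : Config N}
    {r t : ℝ} (hr : 0 < r) (ht : 0 ≤ t) {k l : Fin N} (hkl : k ≠ l) (hP : P k ≠ P l) :
    ∫⁻ d, ENNReal.ofReal (‖(P - t • pairShift i j d) k - (P - t • pairShift i j d) l‖ ^ 2)⁻¹
        ∂displacementMeasure r
      ≤ ENNReal.ofReal (64 * unitBallVolume ^ 2 * r ^ 6 * (‖P k - P l‖ ^ 2)⁻¹) := by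
  -- the statement is symmetric in `k` and `l`, so either neither of them is moved, or `k` is
  wlog hsym : k = i ∨ (k = j ∧ l ≠ i) ∨ (k ≠ i ∧ k ≠ j ∧ l ≠ i ∧ l ≠ j) generalizing k l
  · have h := this hkl.symm hP.symm (by grind)
    simp_rw [norm_sub_rev _ ((P - t • pairShift i j _) k)] at h
    simpa only [norm_sub_rev (P l)] using h
  have hv : P k - P l ≠ 0 := sub_ne_zero.2 hP
  have hrew : ∀ d, (P - t • pairShift i j d) k - (P - t • pairShift i j d) l
      = (P k - P l) - t • (pairShift i j d k - pairShift i j d l) := by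
    intro d
    simp only [Pi.sub_apply, Pi.smul_apply, smul_sub]
    abel
  simp_rw [hrew]
  rcases hsym with rfl | ⟨rfl, hl⟩ | ⟨h1, h2, h3, h4⟩
  · by_cases hl : l = j
    · subst hl
      simp_rw [pairShift_apply_left hij, pairShift_apply_right hij]
      exact lintegral_displacement_sub_le hv hr ht
    · simp_rw [pairShift_apply_left hij, pairShift_apply_of_ne hkl.symm hl, sub_zero]
      exact lintegral_displacement_fst_le hv hr ht
  · simp_rw [pairShift_apply_right hij, pairShift_apply_of_ne hl hkl.symm, sub_zero]
    exact lintegral_displacement_snd_le hv hr ht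
  · simp_rw [pairShift_apply_of_ne h1 h2, pairShift_apply_of_ne h3 h4, sub_zero, smul_zero,
      sub_zero]
    exact lintegral_displacement_const_le hr

lemma g_nonneg {N : ℕ} (X : Config N) : 0 ≤ g X :=
  Finset.sum_nonneg fun _ _ => Finset.sum_nonneg fun _ _ => by positivity

lemma measurable_g {N : ℕ} : Measurable (g : Config N → ℝ) := by
  unfold g
  fun_prop

/-- The constant of the averaging inequality for `g²`. -/
noncomputable def averageConst : ℝ := 64 * unitBallVolume ^ 2

lemma averageConst_pos : 0 < averageConst := by
  have := unitBallVolume_pos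
  unfold averageConst; positivity

/-- Averages of `g²` over motions of two particles are bounded by the value of `g²`, uniformly in
the number and the positions of all particles. The Cauchy–Schwarz inequality reduces this to one
term of `g` at a time. -/
theorem lintegral_g_sq_sub_pairShift_le {N : ℕ} {i j : Fin N} (hij : i ≠ j) {P : Config N}
    (hP : ∀ k l, k ≠ l → P k ≠ P l) {r t : ℝ} (hr : 0 < r) (ht : 0 ≤ t) :
    ∫⁻ d, ENNReal.ofReal (g (P - t • pairShift i j d) ^ 2) ∂displacementMeasure r
      ≤ ENNReal.ofReal (averageConst * r ^ 6) * ENNReal.ofReal (g P ^ 2) := by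
  have hA := averageConst_pos
  set s : Finset (Σ _ : Fin N, Fin N) := Finset.univ.sigma fun i => Finset.Ioi i
  have hgs : ∀ X : Config N, g X = ∑ p ∈ s, ‖X p.1 - X p.2‖⁻¹ := by
    intro X
    simp only [g, one_div]
    rw [Finset.sum_sigma]
  have hs : ∀ p ∈ s, p.1 ≠ p.2 := by
    intro p hp
    simp only [s, Finset.mem_sigma, Finset.mem_univ, true_and, Finset.mem_Ioi] at hp
    exact hp.ne
  have hb : ∀ p ∈ s, 0 < ‖P p.1 - P p.2‖ := fun p hp =>
    norm_pos_iff.2 (sub_ne_zero.2 (hP _ _ (hs p hp)))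
  have hcs : ∀ X : Config N, g X ^ 2
      ≤ ∑ p ∈ s, (g P * ‖P p.1 - P p.2‖) * (‖X p.1 - X p.2‖ ^ 2)⁻¹ := by
    intro X
    have h := Finset.sum_sq_le_sum_mul_sum_of_sq_le_mul s
      (r := fun p => ‖X p.1 - X p.2‖⁻¹)
      (f := fun p => ‖P p.1 - P p.2‖⁻¹)
      (g := fun p => ‖P p.1 - P p.2‖ * (‖X p.1 - X p.2‖ ^ 2)⁻¹)
      (fun p _ => by positivity) (fun p _ => by positivity) (fun p hp => by
        rw [← mul_assoc, inv_mul_cancel₀ (hb p hp).ne', one_mul, inv_pow])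
    rw [← hgs, ← hgs, Finset.mul_sum] at h
    simpa only [mul_assoc] using h
  have hmX : Measurable fun d => P - t • pairShift i j d :=
    measurable_const.sub (measurable_pairShift.const_smul t)
  have hmk : ∀ k, Measurable fun d => (P - t • pairShift i j d) k := fun k =>
    (measurable_pi_apply k).comp hmX
  calc _ ≤ ∫⁻ d, ∑ p ∈ s, ENNReal.ofReal (g P * ‖P p.1 - P p.2‖) * ENNReal.ofReal
          (‖(P - t • pairShift i j d) p.1 - (P - t • pairShift i j d) p.2‖ ^ 2)⁻¹
            ∂displacementMeasure r := by
        refine lintegral_mono fun d => ?_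
        refine (ENNReal.ofReal_le_ofReal (hcs _)).trans (le_of_eq ?_)
        rw [ENNReal.ofReal_sum_of_nonneg fun p _ => by have := g_nonneg P; positivity]
        exact Finset.sum_congr rfl fun p _ =>
          ENNReal.ofReal_mul (mul_nonneg (g_nonneg P) (norm_nonneg _))
    _ = ∑ p ∈ s, ENNReal.ofReal (g P * ‖P p.1 - P p.2‖) * ∫⁻ d, ENNReal.ofReal
          (‖(P - t • pairShift i j d) p.1 - (P - t • pairShift i j d) p.2‖ ^ 2)⁻¹
            ∂displacementMeasure r := by
        have hm : ∀ p : Σ _ : Fin N, Fin N, Measurable fun d => ENNReal.ofReal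
            (‖(P - t • pairShift i j d) p.1 - (P - t • pairShift i j d) p.2‖ ^ 2)⁻¹ := fun p =>
          ((((hmk p.1).sub (hmk p.2)).norm.pow_const 2).inv).ennreal_ofReal
        rw [lintegral_finsetSum _ fun p _ => (hm p).const_mul _]
        exact Finset.sum_congr rfl fun p _ => lintegral_const_mul _ (hm p)
    _ ≤ ∑ p ∈ s, ENNReal.ofReal (g P * ‖P p.1 - P p.2‖) *
          ENNReal.ofReal (averageConst * r ^ 6 * (‖P p.1 - P p.2‖ ^ 2)⁻¹) := by
        refine Finset.sum_le_sum fun p hp => ?_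
        gcongr
        exact lintegral_pair_le hij hr ht (hs p hp) (hP _ _ (hs p hp))
    _ = ∑ p ∈ s, ENNReal.ofReal (averageConst * r ^ 6 * g P * ‖P p.1 - P p.2‖⁻¹) := by
        refine Finset.sum_congr rfl fun p hp => ?_
        rw [← ENNReal.ofReal_mul (mul_nonneg (g_nonneg P) (norm_nonneg _))]
        congr 1
        have := (hb p hp).ne'
        field_simp
    _ = _ := by
        rw [← ENNReal.ofReal_sum_of_nonneg fun p _ => by have := g_nonneg P; positivity,
          ← Finset.mul_sum, ← hgs, ← ENNReal.ofReal_mul (by positivity)]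
        congr 1; ring

/-! ### Directional derivatives of weakly differentiable functions of many particles -/

section direction

variable {N : ℕ} {f : Config N → ℂ} {G : Fin N → Config N → EuclideanSpace ℂ (Fin 3)}

/-- The derivative `v · ∇f` in the direction `v`, in terms of the gradient `G` of `f`. -/
noncomputable def dirDeriv (G : Fin N → Config N → EuclideanSpace ℂ (Fin 3)) (v X : Config N) : ℂ :=
  ∑ k, ∑ a, (v k a) • G k X a

lemma norm_dirDeriv_le (v X : Config N) : ‖dirDeriv G v X‖ ≤ ∑ k, ‖v k‖ * ‖G k X‖ := by
  refine (norm_sum_le _ _).trans (Finset.sum_le_sum fun k _ => (norm_sum_le _ _).trans ?_)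
  simp_rw [norm_smul]
  rw [EuclideanSpace.norm_eq, EuclideanSpace.norm_eq]
  exact Real.sum_mul_le_sqrt_mul_sqrt _ _ _

lemma norm_dirDeriv_pairShift_le {i j : Fin N} (hij : i ≠ j) (d : Space × Space) (X : Config N) :
    ‖dirDeriv G (pairShift i j d) X‖ ≤ ‖d.1‖ * ‖G i X‖ + ‖d.2‖ * ‖G j X‖ := by
  refine (norm_dirDeriv_le _ _).trans (le_of_eq ?_)
  rw [← Finset.sum_subset (Finset.subset_univ {i, j}), Finset.sum_pair hij,
    pairShift_apply_left hij, pairShift_apply_right hij]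
  intro k _ hk
  simp only [Finset.mem_insert, Finset.mem_singleton, not_or] at hk
  rw [pairShift_apply_of_ne hk.1 hk.2, norm_zero, zero_mul]

lemma measurable_dirDeriv (hG : ∀ k, Measurable (G k)) (v : Config N) :
    Measurable (dirDeriv G v) := by
  unfold dirDeriv
  fun_prop

lemma locallyIntegrable_coord (hG : ∀ k, LocallyIntegrable (G k)) (k : Fin N) (a : Fin 3) :
    LocallyIntegrable (fun X => G k X a) :=
  (hG k).mono
    ((EuclideanSpace.proj (𝕜 := ℂ) a).continuous.comp_aestronglyMeasurable
      (hG k).aestronglyMeasurable)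
    (Filter.Eventually.of_forall fun X => PiLp.norm_apply_le (G k X) a)

lemma locallyIntegrable_dirDeriv (hG : ∀ k, LocallyIntegrable (G k)) (v : Config N) :
    LocallyIntegrable (dirDeriv G v) :=
  locallyIntegrable_finsetSum _ fun k _ => locallyIntegrable_finsetSum _ fun a _ =>
    (locallyIntegrable_coord hG k a).smul (v k a)

lemma IsWeakGradient.integral_fderiv (h : IsWeakGradient f G) (v : Config N)
    (φ : Config N → ℝ) (hφ : ContDiff ℝ ∞ φ) (hφc : HasCompactSupport φ) :
    ∫ X, fderiv ℝ φ X v • f X = - ∫ X, φ X • dirDeriv G v X := by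
  obtain ⟨hf, hG, hw⟩ := h
  -- the direction `v` in coordinates; both sides of the claim are linear in `v`
  have hv : v = ∑ k, ∑ a, v k a •
      (Pi.single k (EuclideanSpace.single a 1) : Config N) := by
    ext l b
    simp [Finset.sum_apply, Pi.single_apply, apply_ite, Finset.sum_ite_eq]
  have hL : ∀ X, fderiv ℝ φ X v • f X = ∑ k, ∑ a,
      v k a • (fderiv ℝ φ X (Pi.single k (EuclideanSpace.single a 1)) • f X) := by
    intro X
    conv_lhs => rw [hv]
    simp only [map_sum, map_smul, Finset.sum_smul, smul_assoc]
  have hR : ∀ X, φ X • dirDeriv G v X = ∑ k, ∑ a, v k a • (φ X • G k X a) := by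
    intro X
    simp only [dirDeriv, Finset.smul_sum]
    exact Finset.sum_congr rfl fun k _ => Finset.sum_congr rfl fun a _ => smul_comm _ _ _
  have hiL : ∀ k a, Integrable fun X =>
      v k a • (fderiv ℝ φ X (Pi.single k (EuclideanSpace.single a 1)) • f X) := fun k a =>
    (hf.integrable_smul_left_of_hasCompactSupport
      ((hφ.continuous_fderiv (by simp)).clm_apply continuous_const)
      (hφc.fderiv_apply (𝕜 := ℝ) _)).smul (v k a)
  have hiR : ∀ k a, Integrable fun X => v k a • (φ X • G k X a) := fun k a =>
    ((locallyIntegrable_coord hG k a).integrable_smul_left_of_hasCompactSupport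
      hφ.continuous hφc).smul (v k a)
  simp_rw [hL, hR]
  rw [integral_finsetSum _ fun k _ => integrable_finsetSum _ fun a _ => hiL k a,
    integral_finsetSum _ fun k _ => integrable_finsetSum _ fun a _ => hiR k a,
    ← Finset.sum_neg_distrib]
  refine Finset.sum_congr rfl fun k _ => ?_
  rw [integral_finsetSum _ fun a _ => hiL k a, integral_finsetSum _ fun a _ => hiR k a,
    ← Finset.sum_neg_distrib]
  refine Finset.sum_congr rfl fun a _ => ?_
  rw [integral_smul, integral_smul, hw k a φ hφ hφc, smul_neg]

theorem IsWeakGradient.ae_sub_eq_integral (h : IsWeakGradient f G) (hG : ∀ k, Measurable (G k))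
    (v : Config N) :
    ∀ᵐ X, f (X + v) - f X = ∫ t in Ioc (0 : ℝ) 1, dirDeriv G v (X + t • v) :=
  ae_sub_eq_integral_of_weak_deriv h.1 (measurable_dirDeriv hG v).stronglyMeasurable
    (locallyIntegrable_dirDeriv h.2.1 v) v (h.integral_fderiv v)

end direction

lemma sq_lintegral_le_lintegral_sq {α : Type*} [MeasurableSpace α] {μ : Measure α}
    [IsProbabilityMeasure μ] {h : α → ENNReal} (hh : AEMeasurable h μ) :
    (∫⁻ x, h x ∂μ) ^ 2 ≤ ∫⁻ x, h x ^ 2 ∂μ := by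
  have h1 := ENNReal.lintegral_mul_le_Lp_mul_Lq μ Real.HolderConjugate.two_two hh
    (aemeasurable_const (b := (1 : ENNReal)))
  simp only [Pi.mul_apply, mul_one, ENNReal.rpow_two, one_pow, lintegral_one, measure_univ,
    ENNReal.one_rpow] at h1
  calc _ ≤ ((∫⁻ x, h x ^ 2 ∂μ) ^ (1 / 2 : ℝ)) ^ 2 := by gcongr
    _ = _ := by
      rw [← ENNReal.rpow_two, ← ENNReal.rpow_mul]; norm_num

/-! ### Configurations with a given set of particles in a region -/

/-- The configurations for which the particles in the region `O` are those with label in `A`. -/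
def occupation {N : ℕ} (O : Set Space) (A : Finset (Fin N)) : Set (Config N) :=
  {X | ∀ k, X k ∈ O ↔ k ∈ A}

section occupation

variable {N : ℕ} {O : Set Space} {A : Finset (Fin N)} {i j : Fin N}

lemma measurableSet_occupation (hO : MeasurableSet O) : MeasurableSet (occupation O A) := by
  have : occupation O A = ⋂ k, {X : Config N | X k ∈ O ↔ k ∈ A} := by
    ext X; simp [occupation]
  rw [this]
  refine MeasurableSet.iInter fun k => ?_
  have hk : MeasurableSet {X : Config N | X k ∈ O} := measurable_pi_apply k hO
  by_cases h : k ∈ A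
  · simpa [h] using hk
  · have hc : {X : Config N | X k ∈ O ↔ k ∈ A} = {X | X k ∈ O}ᶜ := by
      ext X; simp [h]
    rw [hc]
    exact hk.compl

lemma comp_swap_mem_occupation (hi : i ∈ A) (hj : j ∈ A) {X : Config N} :
    X ∘ Equiv.swap i j ∈ occupation O A ↔ X ∈ occupation O A := by
  have hA : ∀ k, Equiv.swap i j k ∈ A ↔ k ∈ A := by
    intro k
    rw [Equiv.swap_apply_def]
    split_ifs with h1 h2
    · simp [h1, hi, hj]
    · simp [h2, hi, hj]
    · rfl
  refine ⟨fun h k => ?_, fun h k => ?_⟩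
  · have := h (Equiv.swap i j k)
    simpa [hA] using this
  · rw [Function.comp_apply, h, hA]

lemma add_pairShift_mem_occupation (hij : i ≠ j) (hi : i ∈ A) (hj : j ∈ A) {X : Config N}
    (hX : X ∈ occupation O A) {d : Space × Space} (h1 : X i + d.1 ∈ O) (h2 : X j + d.2 ∈ O) :
    X + pairShift i j d ∈ occupation O A := by
  intro k
  by_cases hki : k = i
  · subst hki; simp [pairShift_apply_left hij, h1, hi]
  by_cases hkj : k = j
  · subst hkj; simp [pairShift_apply_right hij, h2, hj]
  simpa [pairShift_apply_of_ne hki hkj] using hX k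

lemma add_smul_pairShift_mem_occupation (hO : Convex ℝ O) (hij : i ≠ j) (hi : i ∈ A) (hj : j ∈ A)
    {X : Config N} (hX : X ∈ occupation O A) {d : Space × Space}
    (hXd : X + pairShift i j d ∈ occupation O A) {t : ℝ} (ht : t ∈ Ioc (0 : ℝ) 1) :
    X + t • pairShift i j d ∈ occupation O A := by
  have hs : t • pairShift i j d = pairShift i j (t • d) := by
    simp [pairShift, Pi.single_smul']
  rw [hs]
  have h1 : X i + d.1 ∈ O := by
    simpa [pairShift_apply_left hij] using (hXd i).2 hi
  have h2 : X j + d.2 ∈ O := by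
    simpa [pairShift_apply_right hij] using (hXd j).2 hj
  exact add_pairShift_mem_occupation hij hi hj hX
    (hO.add_smul_mem ((hX i).2 hi) h1 ⟨ht.1.le, ht.2⟩)
    (hO.add_smul_mem ((hX j).2 hj) h2 ⟨ht.1.le, ht.2⟩)

lemma displacement_mem_of_mem_occupation (hij : i ≠ j) (hi : i ∈ A) (hj : j ∈ A) {R : ℝ}
    (hR : ∀ x ∈ O, ∀ y ∈ O, ‖x - y‖ ≤ R)
    {X : Config N} (hX : X ∈ occupation O A) {d : Space × Space}
    (hXd : X + pairShift i j d ∈ occupation O A) :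
    d ∈ closedBall (0 : Space) R ×ˢ closedBall (0 : Space) R := by
  have h1 : X i + d.1 ∈ O := by
    simpa [pairShift_apply_left hij] using (hXd i).2 hi
  have h2 : X j + d.2 ∈ O := by
    simpa [pairShift_apply_right hij] using (hXd j).2 hj
  have h3 := hR _ h1 _ ((hX i).2 hi)
  have h4 := hR _ h2 _ ((hX j).2 hj)
  simp only [add_sub_cancel_left] at h3 h4
  simpa using ⟨h3, h4⟩

lemma le_volume_displacements (hij : i ≠ j) (hi : i ∈ A) (hj : j ∈ A) {c : Space} {r : ℝ}
    (hr : 0 ≤ r) (hball : ball c r ⊆ O) {X : Config N} (hX : X ∈ occupation O A) :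
    ENNReal.ofReal (r ^ 6 * unitBallVolume ^ 2)
      ≤ (volume.prod volume) {d : Space × Space | X + pairShift i j d ∈ occupation O A} := by
  have hV := unitBallVolume_pos
  calc ENNReal.ofReal (r ^ 6 * unitBallVolume ^ 2)
      = (volume.prod volume) (ball (c - X i) r ×ˢ ball (c - X j) r) := by
        rw [Measure.prod_prod, volume_ball_eq _ hr, volume_ball_eq _ hr,
          ← ENNReal.ofReal_mul (by positivity)]
        congr 1; ring
    _ ≤ _ := by
        refine measure_mono fun d hd => ?_
        have hmem : ∀ x y : Space, y ∈ ball (c - x) r → x + y ∈ O := by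
          intro x y hy
          apply hball
          rw [mem_ball_iff_norm] at hy ⊢
          rwa [show x + y - c = y - (c - x) by abel]
        exact add_pairShift_mem_occupation hij hi hj hX (hmem _ _ hd.1) (hmem _ _ hd.2)

end occupation

lemma ae_forall_ne {N : ℕ} : ∀ᵐ X : Config N, ∀ k l, k ≠ l → X k ≠ X l := by
  rw [ae_all_iff]; intro k
  rw [ae_all_iff]; intro l
  by_cases hkl : k = l
  · simp [hkl]
  set T : Config N →ₗ[ℝ] Space := 
    LinearMap.proj (R := ℝ) (φ := fun _ => Space) k - LinearMap.proj (φ := fun _ => Space) l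
  have hT : LinearMap.ker T ≠ ⊤ := by
    intro h
    have h1 : (Pi.single k (EuclideanSpace.single 0 1) : Config N) ∈ LinearMap.ker T := by
      rw [h]; trivial
    simp [T, Ne.symm hkl] at h1
  filter_upwards [measure_eq_zero_iff_ae_notMem.1 (Measure.addHaar_submodule volume _ hT)]
    with X hX _ h
  exact hX (by simp [T, h])

lemma g_comp_perm {N : ℕ} (σ : Equiv.Perm (Fin N)) (X : Config N) : g (X ∘ σ) = g X := by
  -- the sum over `i < j` is half the sum over all `i, j`: the summand for `i = j` is `1 / 0 = 0`
  have key : ∀ Y : Config N, 2 * g Y = ∑ i, ∑ j, 1 / ‖Y i - Y j‖ := by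
    intro Y
    have h1 : ∀ i, ∑ j, 1 / ‖Y i - Y j‖
        = ∑ j ∈ Finset.Ioi i, 1 / ‖Y i - Y j‖ + ∑ j ∈ Finset.Iio i, 1 / ‖Y i - Y j‖ := by
      intro i
      have hd : Disjoint (Finset.Ioi i) (Finset.Iio i) := by
        rw [Finset.disjoint_left]; intro a ha hb
        exact absurd (Finset.mem_Ioi.1 ha) (not_lt.2 (Finset.mem_Iio.1 hb).le)
      rw [← Finset.sum_union hd]
      refine (Finset.sum_subset (Finset.subset_univ _) fun j _ hj => ?_).symm
      have : j = i := by
        simp only [Finset.mem_union, Finset.mem_Ioi, Finset.mem_Iio, not_or, not_lt] at hj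
        exact le_antisymm hj.1 hj.2
      simp [this]
    have h2 : ∑ i, ∑ j ∈ Finset.Iio i, 1 / ‖Y i - Y j‖ = g Y := by
      rw [Finset.sum_comm' (t' := Finset.univ) (s' := fun j => Finset.Ioi j) (by simp)]
      simp_rw [norm_sub_rev (Y _) (Y _), g]
    simp_rw [h1, Finset.sum_add_distrib, h2, two_mul, g]
  have h : 2 * g (X ∘ σ) = 2 * g X := by
    rw [key, key]
    simp only [Function.comp_apply]
    rw [Equiv.sum_comp σ fun i => ∑ j, 1 / ‖X i - X (σ j)‖]
    exact Finset.sum_congr rfl fun i _ => Equiv.sum_comp σ fun j => 1 / ‖X i - X j‖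
  linarith

lemma measurePreserving_comp_perm {N : ℕ} (σ : Equiv.Perm (Fin N)) :
    MeasurePreserving (fun X : Config N => X ∘ σ) volume volume := by
  have h := volume_measurePreserving_piCongrLeft (fun _ : Fin N => Space) σ.symm
  convert h using 1
  ext X k
  simp [MeasurableEquiv.coe_piCongrLeft, Equiv.piCongrLeft_apply]

/-! ### The two-particle inequality -/

section pair

variable {N : ℕ}

/-- The density `g²` as a function with values in `[0, ∞]`. -/
noncomputable def weight (X : Config N) : ENNReal := ENNReal.ofReal (g X ^ 2)

lemma measurable_weight : Measurable (weight (N := N)) := (measurable_g.pow_const 2).ennreal_ofReal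

/-- The oscillation of `f` at `X` within `S` under motions of the particles `i` and `j`:
the integral of `|f X - f Z|²` over all `Z ∈ S` which differ from `X` in these positions only. -/
noncomputable def pairOscillation (f : Config N → ℂ) (S : Set (Config N)) (i j : Fin N)
    (X : Config N) : ENNReal :=
  ∫⁻ d, S.indicator 1 (X + pairShift i j d) * ‖f X - f (X + pairShift i j d)‖ₑ ^ 2
    ∂(volume.prod volume)

variable {f : Config N → ℂ} {G : Fin N → Config N → EuclideanSpace ℂ (Fin 3)}
  {O : Set Space} {A : Finset (Fin N)} {i j : Fin N} {S : Set (Config N)}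

lemma measurable_add_pairShift (X : Config N) : Measurable fun d => X + pairShift i j d :=
  measurable_const.add measurable_pairShift

lemma measurable_indicator_one (hS : MeasurableSet S) :
    Measurable (S.indicator (1 : Config N → ENNReal)) :=
  measurable_one.indicator hS

lemma measurable_oscillation_integrand (hf : Measurable f) (hS : MeasurableSet S) :
    Measurable fun p : Config N × (Space × Space) =>
      S.indicator (1 : Config N → ENNReal) (p.1 + pairShift i j p.2)
        * ‖f p.1 - f (p.1 + pairShift i j p.2)‖ₑ ^ 2 := by
  have hm : Measurable fun p : Config N × (Space × Space) => p.1 + pairShift i j p.2 :=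
    measurable_fst.add (measurable_pairShift.comp measurable_snd)
  exact ((measurable_indicator_one hS).comp hm).mul
    (((hf.comp measurable_fst).sub (hf.comp hm)).enorm.pow_const 2)

/-- The exchange of the particles `i` and `j` changes the base point of the oscillation only, since
it does not change the set of configurations reached by moving these particles. -/
lemma pairOscillation_comp_swap (hij : i ≠ j) (X : Config N) :
    pairOscillation f S i j (X ∘ Equiv.swap i j)
      = ∫⁻ d, S.indicator 1 (X + pairShift i j d)
          * ‖f (X ∘ Equiv.swap i j) - f (X + pairShift i j d)‖ₑ ^ 2 ∂(volume.prod volume) := by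
  rw [pairOscillation, ← lintegral_add_right_eq_self (fun d =>
    S.indicator 1 (X + pairShift i j d)
      * ‖f (X ∘ Equiv.swap i j) - f (X + pairShift i j d)‖ₑ ^ 2) (X j - X i, X i - X j)]
  refine lintegral_congr fun d => ?_
  have h : X ∘ Equiv.swap i j + pairShift i j d
      = X + pairShift i j (d + (X j - X i, X i - X j)) := by
    ext1 k
    by_cases hki : k = i
    · subst hki
      simp only [Pi.add_apply, Function.comp_apply, Equiv.swap_apply_left,
        pairShift_apply_left hij, Prod.fst_add]
      abel
    by_cases hkj : k = j
    · subst hkj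
      simp only [Pi.add_apply, Function.comp_apply, Equiv.swap_apply_right,
        pairShift_apply_right hij, Prod.snd_add]
      abel
    simp [pairShift_apply_of_ne hki hkj, Equiv.swap_apply_of_ne_of_ne hki hkj]
  rw [h]

lemma four_mul_enorm_sq_le (a z : ℂ) :
    4 * ‖a‖ₑ ^ 2 ≤ 2 * ‖a - z‖ₑ ^ 2 + 2 * ‖-a - z‖ₑ ^ 2 := by
  have h : 4 * ‖a‖ ^ 2 ≤ 2 * ‖a - z‖ ^ 2 + 2 * ‖-a - z‖ ^ 2 := by
    have h1 : 2 * ‖a‖ ≤ ‖a - z‖ + ‖-a - z‖ := by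
      calc 2 * ‖a‖ = ‖(a - z) - (-a - z)‖ := by
            rw [show (a - z) - (-a - z) = 2 * a by ring, norm_mul]; simp
        _ ≤ _ := norm_sub_le _ _
    nlinarith [norm_nonneg a, sq_nonneg (‖a - z‖ - ‖-a - z‖)]
  have h2 := ENNReal.ofReal_le_ofReal h
  rw [ENNReal.ofReal_add (by positivity) (by positivity), ENNReal.ofReal_mul (by norm_num),
    ENNReal.ofReal_mul (by norm_num), ENNReal.ofReal_mul (by norm_num),
    ENNReal.ofReal_pow (norm_nonneg _), ENNReal.ofReal_pow (norm_nonneg _),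
    ENNReal.ofReal_pow (norm_nonneg _), ofReal_norm, ofReal_norm, ofReal_norm] at h2
  simpa using h2

/-- An antisymmetric function is controlled by its oscillation: `2 f X` is the difference of
`f X - f Z` and `f X' - f Z`, where `X'` arises from `X` by the exchange of `i` and `j`. -/
lemma enorm_sq_le_pairOscillation (hf : Measurable f) (hO : MeasurableSet O) (hij : i ≠ j)
    (hi : i ∈ A) (hj : j ∈ A) {c : Space} {r : ℝ} (hr : 0 ≤ r) (hball : ball c r ⊆ O)
    {X : Config N} (hX : X ∈ occupation O A) (hfX : f (X ∘ Equiv.swap i j) = - f X) :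
    ENNReal.ofReal (r ^ 6 * unitBallVolume ^ 2) * (4 * ‖f X‖ₑ ^ 2)
      ≤ 2 * pairOscillation f (occupation O A) i j X
        + 2 * pairOscillation f (occupation O A) i j (X ∘ Equiv.swap i j) := by
  have hS : MeasurableSet (occupation O A) := measurableSet_occupation hO
  have hm := measurable_add_pairShift (i := i) (j := j) X
  have hχ : Measurable fun d => (occupation O A).indicator (1 : Config N → ENNReal)
      (X + pairShift i j d) := (measurable_indicator_one hS).comp hm
  have hfm := hf.comp hm
  have hD : MeasurableSet {d : Space × Space | X + pairShift i j d ∈ occupation O A} := hm hS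
  rw [pairOscillation_comp_swap hij, pairOscillation, hfX]
  have hm1 : ∀ z : ℂ, Measurable fun d => (occupation O A).indicator 1 (X + pairShift i j d)
      * ‖z - f (X + pairShift i j d)‖ₑ ^ 2 := fun z =>
    hχ.mul ((measurable_const.sub hfm).enorm.pow_const 2)
  rw [← lintegral_const_mul _ (hm1 _), ← lintegral_const_mul _ (hm1 _),
    ← lintegral_add_left ((hm1 _).const_mul _)]
  calc _ ≤ (volume.prod volume) {d : Space × Space | X + pairShift i j d ∈ occupation O A}
          * (4 * ‖f X‖ₑ ^ 2) := by
        gcongr; exact le_volume_displacements hij hi hj hr hball hX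
    _ = ∫⁻ d, (occupation O A).indicator 1 (X + pairShift i j d) * (4 * ‖f X‖ₑ ^ 2)
          ∂(volume.prod volume) := by
        rw [lintegral_mul_const _ hχ, ← lintegral_indicator_one hD]
        rfl
    _ ≤ _ := by
        refine lintegral_mono fun d => ?_
        calc _ ≤ (occupation O A).indicator 1 (X + pairShift i j d)
                * (2 * ‖f X - f (X + pairShift i j d)‖ₑ ^ 2
                  + 2 * ‖-f X - f (X + pairShift i j d)‖ₑ ^ 2) := by
              gcongr; exact four_mul_enorm_sq_le _ _
          _ = _ := by ring

/-- The kinetic energy density of the particles `i` and `j`. -/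
noncomputable def pairEnergy (G : Fin N → Config N → EuclideanSpace ℂ (Fin 3)) (i j : Fin N)
    (X : Config N) : ENNReal := ‖G i X‖ₑ ^ 2 + ‖G j X‖ₑ ^ 2

lemma measurable_pairEnergy (hG : ∀ k, Measurable (G k)) : Measurable (pairEnergy G i j) :=
  ((hG i).enorm.pow_const 2).add ((hG j).enorm.pow_const 2)

lemma enorm_dirDeriv_pairShift_sq_le (hij : i ≠ j) {R : ℝ} {d : Space × Space}
    (hd : d ∈ closedBall (0 : Space) R ×ˢ closedBall (0 : Space) R) (X : Config N) :
    ‖dirDeriv G (pairShift i j d) X‖ₑ ^ 2 ≤ ENNReal.ofReal (2 * R ^ 2) * pairEnergy G i j X := by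
  have h1 : ‖d.1‖ ≤ R := by simpa using hd.1
  have h2 : ‖d.2‖ ≤ R := by simpa using hd.2
  have hR : 0 ≤ R := (norm_nonneg _).trans h1
  have h : ‖dirDeriv G (pairShift i j d) X‖ ^ 2 ≤ 2 * R ^ 2 * (‖G i X‖ ^ 2 + ‖G j X‖ ^ 2) := by
    calc _ ≤ (‖d.1‖ * ‖G i X‖ + ‖d.2‖ * ‖G j X‖) ^ 2 := by
          gcongr; exact norm_dirDeriv_pairShift_le hij d X
      _ ≤ (R * ‖G i X‖ + R * ‖G j X‖) ^ 2 := by gcongr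
      _ ≤ _ := by nlinarith [sq_nonneg (R * ‖G i X‖ - R * ‖G j X‖)]
  have h3 := ENNReal.ofReal_le_ofReal h
  rw [ENNReal.ofReal_mul (by positivity), ENNReal.ofReal_add (by positivity) (by positivity),
    ENNReal.ofReal_pow (norm_nonneg _), ENNReal.ofReal_pow (norm_nonneg _),
    ENNReal.ofReal_pow (norm_nonneg _), ofReal_norm, ofReal_norm, ofReal_norm] at h3
  exact h3

/-- For a fixed motion `d` of the particles `i` and `j`, the integrated oscillation is bounded by
the energy along the straight paths from `X` to `X + d`; the point `P` on the path is the new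
variable of integration. -/
lemma lintegral_oscillation_fixed_le (hG : ∀ k, Measurable (G k))
    (hw : IsWeakGradient f G) (hO : MeasurableSet O) (hOc : Convex ℝ O) (hij : i ≠ j)
    (hi : i ∈ A) (hj : j ∈ A) {R : ℝ} (hR : ∀ x ∈ O, ∀ y ∈ O, ‖x - y‖ ≤ R) (d : Space × Space) :
    ∫⁻ X, (occupation O A).indicator 1 X * weight X *
        ((occupation O A).indicator 1 (X + pairShift i j d)
          * ‖f X - f (X + pairShift i j d)‖ₑ ^ 2)
      ≤ ENNReal.ofReal (2 * R ^ 2) * ∫⁻ t in Ioc (0 : ℝ) 1, ∫⁻ P,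
          (occupation O A).indicator 1 P * pairEnergy G i j P *
            ((closedBall (0 : Space) R ×ˢ closedBall (0 : Space) R).indicator 1 d
              * weight (P - t • pairShift i j d)) := by
  set S : Set (Config N) := occupation O A with hSdef
  set B := closedBall (0 : Space) R ×ˢ closedBall (0 : Space) R
  set v : Config N := pairShift i j d
  have hS : MeasurableSet S := measurableSet_occupation hO
  have hχ := measurable_indicator_one hS
  have hE := measurable_pairEnergy (i := i) (j := j) hG
  have hW := measurable_weight (N := N)
  have hprob : IsProbabilityMeasure (volume.restrict (Ioc (0 : ℝ) 1)) := ⟨by simp⟩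
  have hmvt : Measurable fun p : Config N × ℝ => p.1 + p.2 • v := by fun_prop
  have hmeas : Measurable fun p : Config N × ℝ =>
      S.indicator 1 p.1 * weight p.1 * (S.indicator 1 (p.1 + v)
        * pairEnergy G i j (p.1 + p.2 • v)) :=
    ((hχ.comp measurable_fst).mul (hW.comp measurable_fst)).mul
      ((hχ.comp (measurable_fst.add_const v)).mul (hE.comp hmvt))
  calc _ ≤ ∫⁻ X, ENNReal.ofReal (2 * R ^ 2) * ∫⁻ t in Ioc (0 : ℝ) 1,
        S.indicator 1 X * weight X * (S.indicator 1 (X + v) * pairEnergy G i j (X + t • v)) := by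
        refine lintegral_mono_ae ?_
        filter_upwards [hw.ae_sub_eq_integral hG v] with X hX
        by_cases h1 : X ∈ S
        swap
        · simp [indicator_of_notMem h1]
        by_cases h2 : X + v ∈ S
        swap
        · simp [indicator_of_notMem h2]
        have hd : d ∈ B := displacement_mem_of_mem_occupation hij hi hj hR h1 h2
        have hmt : Measurable fun t : ℝ => X + t • v := by fun_prop
        have hEt : Measurable fun t : ℝ => pairEnergy G i j (X + t • v) := hE.comp hmt
        rw [lintegral_const_mul _ (hEt.const_mul _), lintegral_const_mul _ hEt, indicator_of_mem h1,
          indicator_of_mem h2]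
        simp only [Pi.one_apply, one_mul]
        rw [mul_left_comm]
        gcongr
        rw [← enorm_neg, neg_sub, hX]
        calc _ ≤ (∫⁻ t in Ioc (0 : ℝ) 1, ‖dirDeriv G v (X + t • v)‖ₑ) ^ 2 := by
              gcongr; exact enorm_integral_le_lintegral_enorm _
          _ ≤ ∫⁻ t in Ioc (0 : ℝ) 1, ‖dirDeriv G v (X + t • v)‖ₑ ^ 2 :=
              sq_lintegral_le_lintegral_sq
                ((measurable_dirDeriv hG v).comp hmt).enorm.aemeasurable
          _ ≤ ∫⁻ t in Ioc (0 : ℝ) 1,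
                ENNReal.ofReal (2 * R ^ 2) * pairEnergy G i j (X + t • v) :=
              lintegral_mono fun t => enorm_dirDeriv_pairShift_sq_le hij hd _
          _ = ENNReal.ofReal (2 * R ^ 2) * ∫⁻ t in Ioc (0 : ℝ) 1, pairEnergy G i j (X + t • v) :=
              lintegral_const_mul _ hEt
    _ = ENNReal.ofReal (2 * R ^ 2) * ∫⁻ t in Ioc (0 : ℝ) 1, ∫⁻ X,
        S.indicator 1 X * weight X * (S.indicator 1 (X + v) * pairEnergy G i j (X + t • v)) := by
        rw [lintegral_const_mul _ hmeas.lintegral_prod_right',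
          lintegral_lintegral_swap hmeas.aemeasurable]
    _ = ENNReal.ofReal (2 * R ^ 2) * ∫⁻ t in Ioc (0 : ℝ) 1, ∫⁻ P,
        S.indicator 1 (P - t • v) * weight (P - t • v)
          * (S.indicator 1 (P - t • v + v) * pairEnergy G i j P) := by
        congr 2; ext1 t
        rw [← lintegral_sub_right_eq_self _ (t • v)]
        simp
    _ ≤ _ := by
        gcongr _ * ?_
        refine setLIntegral_mono' measurableSet_Ioc fun t ht => lintegral_mono fun P => ?_
        by_cases h1 : P - t • v ∈ S
        swap
        · simp [indicator_of_notMem h1]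
        by_cases h2 : P - t • v + v ∈ S
        swap
        · simp [indicator_of_notMem h2]
        have hd : d ∈ B := displacement_mem_of_mem_occupation hij hi hj hR h1 h2
        have hP : P ∈ S := by
          have h := add_smul_pairShift_mem_occupation hOc hij hi hj h1 h2 ht
          rwa [sub_add_cancel] at h
        rw [indicator_of_mem h1, indicator_of_mem h2, indicator_of_mem hd, indicator_of_mem hP]
        simp only [Pi.one_apply, one_mul]
        exact (mul_comm _ _).le

/-- The weighted energy of the particles `i` and `j` controls the weighted integral of the
oscillation. -/
lemma lintegral_pairOscillation_le (hf : Measurable f) (hG : ∀ k, Measurable (G k))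
    (hw : IsWeakGradient f G) (hO : MeasurableSet O) (hOc : Convex ℝ O) (hij : i ≠ j)
    (hi : i ∈ A) (hj : j ∈ A) {R : ℝ} (hR0 : 0 < R) (hR : ∀ x ∈ O, ∀ y ∈ O, ‖x - y‖ ≤ R) :
    ∫⁻ X, (occupation O A).indicator 1 X * weight X * pairOscillation f (occupation O A) i j X
      ≤ ENNReal.ofReal (2 * R ^ 2 * (averageConst * R ^ 6)) *
          ∫⁻ X in occupation O A, weight X * pairEnergy G i j X := by
  set S : Set (Config N) := occupation O A with hSdef
  set B := closedBall (0 : Space) R ×ˢ closedBall (0 : Space) R with hB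
  have hBm : MeasurableSet B := measurableSet_closedBall.prod measurableSet_closedBall
  have hS : MeasurableSet S := measurableSet_occupation hO
  have hχ := measurable_indicator_one hS
  have hE := measurable_pairEnergy (i := i) (j := j) hG
  have hW := measurable_weight (N := N)
  have hχB : Measurable (B.indicator (1 : Space × Space → ENNReal)) :=
    measurable_one.indicator hBm
  have hosc := measurable_oscillation_integrand (i := i) (j := j) hf hS
  have hosc' : Measurable (Function.uncurry fun (X : Config N) (d : Space × Space) =>
      S.indicator 1 X * weight X * (S.indicator 1 (X + pairShift i j d)
        * ‖f X - f (X + pairShift i j d)‖ₑ ^ 2)) :=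
    ((hχ.comp measurable_fst).mul (hW.comp measurable_fst)).mul hosc
  have hm2 : Measurable fun p : ((Space × Space) × ℝ) × Config N =>
      p.2 - p.1.2 • pairShift i j p.1.1 :=
    measurable_snd.sub ((measurable_snd.comp measurable_fst).smul
      (measurable_pairShift.comp (measurable_fst.comp measurable_fst)))
  have hbig : Measurable fun p : ((Space × Space) × ℝ) × Config N =>
      S.indicator 1 p.2 * pairEnergy G i j p.2 *
        (B.indicator 1 p.1.1 * weight (p.2 - p.1.2 • pairShift i j p.1.1)) :=
    ((hχ.comp measurable_snd).mul (hE.comp measurable_snd)).mul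
      ((hχB.comp (measurable_fst.comp measurable_fst)).mul (hW.comp hm2))
  have hA := averageConst_pos
  calc _ = ∫⁻ X, ∫⁻ d, S.indicator 1 X * weight X *
        (S.indicator 1 (X + pairShift i j d)
          * ‖f X - f (X + pairShift i j d)‖ₑ ^ 2) ∂(volume.prod volume) := by
        refine lintegral_congr fun X => ?_
        rw [pairOscillation, lintegral_const_mul]
        exact hosc.comp measurable_prodMk_left
    _ = ∫⁻ d, ∫⁻ X, S.indicator 1 X * weight X *
        (S.indicator 1 (X + pairShift i j d)
          * ‖f X - f (X + pairShift i j d)‖ₑ ^ 2) ∂volume ∂(volume.prod volume) :=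
        lintegral_lintegral_swap hosc'.aemeasurable
    _ ≤ ∫⁻ d, ENNReal.ofReal (2 * R ^ 2) * ∫⁻ t in Ioc (0 : ℝ) 1, ∫⁻ P,
          S.indicator 1 P * pairEnergy G i j P *
            (B.indicator 1 d * weight (P - t • pairShift i j d)) ∂volume ∂volume
          ∂(volume.prod volume) :=
        lintegral_mono fun d => lintegral_oscillation_fixed_le hG hw hO hOc hij hi hj hR d
    _ = ENNReal.ofReal (2 * R ^ 2) * ∫⁻ t in Ioc (0 : ℝ) 1, ∫⁻ P, ∫⁻ d,
          S.indicator 1 P * pairEnergy G i j P *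
            (B.indicator 1 d * weight (P - t • pairShift i j d))
          ∂(volume.prod volume) ∂volume ∂volume := by
        have h1 := hbig.lintegral_prod_right' (ν := volume)
        rw [lintegral_const_mul _ h1.lintegral_prod_right',
          lintegral_lintegral_swap h1.aemeasurable]
        congr 2; ext1 t
        refine lintegral_lintegral_swap (Measurable.aemeasurable ?_)
        exact hbig.comp ((measurable_fst.prodMk measurable_const).prodMk measurable_snd)
    _ = ENNReal.ofReal (2 * R ^ 2) * ∫⁻ t in Ioc (0 : ℝ) 1, ∫⁻ P,
          S.indicator 1 P * pairEnergy G i j P *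
            ∫⁻ d, weight (P - t • pairShift i j d) ∂displacementMeasure R := by
        congr 2; ext1 t
        refine lintegral_congr fun P => ?_
        have h2 : Measurable fun d => weight (P - t • pairShift i j d) :=
          hW.comp (measurable_const.sub (measurable_pairShift.const_smul t))
        have h3 : Measurable fun d =>
            B.indicator (1 : Space × Space → ENNReal) d * weight (P - t • pairShift i j d) :=
          hχB.mul h2
        rw [lintegral_const_mul _ h3, displacementMeasure, Measure.prod_restrict,
          ← lintegral_indicator hBm]
        congr 2; ext1 d
        by_cases hd : d ∈ B
        · simp [indicator_of_mem hd]
        · simp [indicator_of_notMem hd]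
    _ ≤ ENNReal.ofReal (2 * R ^ 2) * ∫⁻ _ in Ioc (0 : ℝ) 1,
          ENNReal.ofReal (averageConst * R ^ 6) *
            ∫⁻ P in S, weight P * pairEnergy G i j P := by
        gcongr _ * ?_
        refine setLIntegral_mono' measurableSet_Ioc fun t ht => ?_
        have hWE : Measurable fun P => weight P * pairEnergy G i j P := hW.mul hE
        rw [← lintegral_indicator hS, ← lintegral_const_mul _ (hWE.indicator hS)]
        refine lintegral_mono_ae ?_
        filter_upwards [ae_forall_ne] with P hP
        by_cases hPS : P ∈ S
        · rw [indicator_of_mem hPS, indicator_of_mem hPS, Pi.one_apply, one_mul, mul_comm,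
            ← mul_assoc]
          gcongr
          exact lintegral_g_sq_sub_pairShift_le hij hP hR0 ht.1.le
        · simp [indicator_of_notMem hPS]
    _ = _ := by
        rw [setLIntegral_const, ENNReal.ofReal_mul (p := 2 * R ^ 2) (by positivity)]
        simp only [Real.volume_Ioc, sub_zero, ENNReal.ofReal_one, mul_one, mul_assoc]

/-- The Poincaré inequality with weight `g²` for functions which are antisymmetric in the
positions of two particles `i` and `j` in a convex region of size `L`: the energy of these two
particles is bounded below uniformly in the number and the positions of all other particles. -/
theorem lintegral_occupation_le (hf : Measurable f) (hG : ∀ k, Measurable (G k))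
    (hw : IsWeakGradient f G) (hij : i ≠ j)
    (hanti : ∀ᵐ X : Config N, f (X ∘ Equiv.swap i j) = - f X)
    (hO : MeasurableSet O) (hOc : Convex ℝ O)
    {L : ℝ} (hL : 0 < L) {c : Space} (hball : ball c (L / 2) ⊆ O)
    (hdiam : ∀ x ∈ O, ∀ y ∈ O, ‖x - y‖ ≤ 2 * L) (hi : i ∈ A) (hj : j ∈ A) :
    ∫⁻ X in occupation O A, weight X * ‖f X‖ₑ ^ 2
      ≤ ENNReal.ofReal (2 ^ 21 * L ^ 2) *
          ∫⁻ X in occupation O A, weight X * pairEnergy G i j X := by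
  set S : Set (Config N) := occupation O A with hSdef
  have hS : MeasurableSet S := measurableSet_occupation hO
  have hχ := measurable_indicator_one hS
  have hW := measurable_weight (N := N)
  have hV := unitBallVolume_pos
  set c₀ : ℝ := (L / 2) ^ 6 * unitBallVolume ^ 2 with hc₀
  have hc₀pos : 0 < c₀ := by positivity
  have hosc : Measurable (pairOscillation f S i j) :=
    (measurable_oscillation_integrand hf hS).lintegral_prod_right'
  set J := ∫⁻ X, S.indicator 1 X * weight X * pairOscillation f S i j X with hJ
  have hJm : Measurable fun X => S.indicator 1 X * weight X * pairOscillation f S i j X :=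
    (hχ.mul hW).mul hosc
  have hσ := measurePreserving_comp_perm (Equiv.swap i j)
  have hJσ : ∫⁻ X, S.indicator 1 X * weight X * pairOscillation f S i j (X ∘ Equiv.swap i j)
      = J := by
    rw [hJ, ← hσ.lintegral_comp hJm]
    refine lintegral_congr fun X => ?_
    have h1 : S.indicator (1 : Config N → ENNReal) (X ∘ Equiv.swap i j) = S.indicator 1 X := by
      by_cases h : X ∈ S
      · rw [indicator_of_mem h, indicator_of_mem ((comp_swap_mem_occupation hi hj).2 h)]; rfl
      · rw [indicator_of_notMem h,
          indicator_of_notMem fun h' => h ((comp_swap_mem_occupation hi hj).1 h')]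
    rw [h1, weight, weight, g_comp_perm]
  have hJm' : Measurable fun X =>
      S.indicator 1 X * weight X * pairOscillation f S i j (X ∘ Equiv.swap i j) :=
    (hχ.mul hW).mul (hosc.comp hσ.measurable)
  have hfm : Measurable fun X => weight X * ‖f X‖ₑ ^ 2 := hW.mul (hf.enorm.pow_const 2)
  have hmain : ENNReal.ofReal c₀ * 4 * ∫⁻ X in S, weight X * ‖f X‖ₑ ^ 2 ≤ 4 * J := by
    calc _ = ∫⁻ X, ENNReal.ofReal c₀ * 4 * S.indicator (fun X => weight X * ‖f X‖ₑ ^ 2) X := by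
          rw [← lintegral_indicator hS, lintegral_const_mul _ (hfm.indicator hS)]
      _ ≤ ∫⁻ X, (2 * (S.indicator 1 X * weight X * pairOscillation f S i j X)
            + 2 * (S.indicator 1 X * weight X
              * pairOscillation f S i j (X ∘ Equiv.swap i j))) := by
          refine lintegral_mono_ae ?_
          filter_upwards [hanti] with X hX
          by_cases hXS : X ∈ S
          · rw [indicator_of_mem hXS, indicator_of_mem hXS, Pi.one_apply, one_mul]
            have h := enorm_sq_le_pairOscillation hf hO hij hi hj (by positivity) hball hXS hX
            calc _ = weight X * (ENNReal.ofReal c₀ * (4 * ‖f X‖ₑ ^ 2)) := by ring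
              _ ≤ weight X * (2 * pairOscillation f S i j X
                    + 2 * pairOscillation f S i j (X ∘ Equiv.swap i j)) := by gcongr
              _ = _ := by ring
          · simp [indicator_of_notMem hXS]
      _ = 2 * J + 2 * J := by
          rw [lintegral_add_left (hJm.const_mul _), lintegral_const_mul _ hJm,
            lintegral_const_mul _ hJm', hJσ]
      _ = 4 * J := by ring
  have hJle := lintegral_pairOscillation_le hf hG hw hO hOc hij hi hj (by positivity) hdiam
  -- the volume of the unit ball cancels, which leaves the numerical constant `2²¹`
  have hA : 2 * (2 * L) ^ 2 * (averageConst * (2 * L) ^ 6) = c₀ * (2 ^ 21 * L ^ 2) := by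
    rw [hc₀, averageConst]; ring
  rw [hA, ENNReal.ofReal_mul hc₀pos.le, mul_assoc] at hJle
  have h4 : ENNReal.ofReal c₀ * 4 * ∫⁻ X in S, weight X * ‖f X‖ₑ ^ 2
      ≤ ENNReal.ofReal c₀ * 4 * (ENNReal.ofReal (2 ^ 21 * L ^ 2) *
          ∫⁻ X in S, weight X * pairEnergy G i j X) := by
    refine hmain.trans ?_
    calc 4 * J ≤ 4 * (ENNReal.ofReal c₀ * (ENNReal.ofReal (2 ^ 21 * L ^ 2) *
          ∫⁻ X in S, weight X * pairEnergy G i j X)) := by gcongr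
      _ = _ := by ring
  refine (ENNReal.mul_le_mul_iff_right ?_ ?_).1 h4
  · simp [hc₀pos]
  · exact ENNReal.mul_ne_top ENNReal.ofReal_ne_top (by simp)

end pair

/-! ### Summation over the sets of particles in the region -/

/-- If any two distinct elements of `A` of the same class satisfy `F ≤ K (E i + E j)`, then at most
one element of each of the `q` classes has `2 K E i < F`. -/
lemma card_sub_mul_le {ι : Type*} [DecidableEq ι] {q : ℕ} (c : ι → Fin q) (A : Finset ι)
    {F K : ℝ} {E : ι → ℝ} (hF : 0 ≤ F) (hK : 0 ≤ K) (hE : ∀ i, 0 ≤ E i)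
    (h : ∀ i ∈ A, ∀ j ∈ A, i ≠ j → c i = c j → F ≤ K * (E i + E j)) :
    ((A.card : ℝ) - q) * F ≤ 2 * K * ∑ i ∈ A, E i := by
  set B := A.filter fun i => 2 * K * E i < F
  have hB : (B.card : ℝ) ≤ q := by
    -- two elements of `B` in the same class would satisfy `K (E i + E j) < F`
    have h1 : B.card ≤ (Finset.univ : Finset (Fin q)).card := by
      refine Finset.card_le_card_of_injOn c (fun _ _ => Finset.mem_coe.2 (Finset.mem_univ _)) ?_
      intro i hi j hj hij
      by_contra hne
      have hi' := Finset.mem_filter.1 hi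
      have hj' := Finset.mem_filter.1 hj
      have := h i hi'.1 j hj'.1 hne hij
      linarith [hi'.2, hj'.2]
    rw [Finset.card_univ, Fintype.card_fin] at h1
    exact_mod_cast h1
  have hcard : ((A.filter fun i => ¬ 2 * K * E i < F).card : ℝ) = A.card - B.card := by
    have := Finset.card_filter_add_card_filter_not (s := A) fun i => 2 * K * E i < F
    rw [← this]; push_cast; ring
  calc ((A.card : ℝ) - q) * F ≤ (A.card - B.card) * F := by gcongr
    _ = ∑ i ∈ A.filter (fun i => ¬ 2 * K * E i < F), F := by
        rw [Finset.sum_const, nsmul_eq_mul, hcard]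
    _ ≤ ∑ i ∈ A.filter (fun i => ¬ 2 * K * E i < F), 2 * K * E i :=
        Finset.sum_le_sum fun i hi => not_lt.1 (Finset.mem_filter.1 hi).2
    _ ≤ ∑ i ∈ A, 2 * K * E i :=
        Finset.sum_le_sum_of_subset_of_nonneg (Finset.filter_subset _ _) fun i _ _ =>
          mul_nonneg (by positivity) (hE i)
    _ = _ := by rw [Finset.mul_sum]

section sum

variable {N : ℕ} {O : Set Space}

lemma sum_indicator_occupation (h : Config N → ℝ) (φ : Finset (Fin N) → ℝ) (X : Config N)
    [DecidablePred fun k => X k ∈ O] :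
    ∑ A, φ A * (occupation O A).indicator h X
      = φ (Finset.univ.filter fun k => X k ∈ O) * h X := by
  rw [Finset.sum_eq_single (Finset.univ.filter fun k => X k ∈ O)]
  · rw [indicator_of_mem]
    intro k; simp
  · intro A _ hA
    rw [indicator_of_notMem, mul_zero]
    intro hX
    apply hA
    ext k
    simp [hX k]
  · simp

lemma sum_setIntegral_occupation (hO : MeasurableSet O) {h : Config N → ℝ} (hh : Integrable h)
    (φ : Finset (Fin N) → ℝ) (ψ : Config N → ℝ)
    (hφψ : ∀ X A, X ∈ occupation O A → φ A = ψ X) :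
    ∫ X, h X * ψ X = ∑ A, φ A * ∫ X in occupation O A, h X := by
  classical
  have hm : ∀ A : Finset (Fin N), MeasurableSet (occupation O A) := fun A =>
    measurableSet_occupation hO
  simp_rw [← integral_indicator (hm _), ← integral_const_mul]
  rw [← integral_finsetSum _ fun A _ => (hh.indicator (hm A)).const_mul _]
  refine integral_congr_ae (Filter.Eventually.of_forall fun X => ?_)
  simp only
  rw [sum_indicator_occupation, hφψ X _ (fun k => by simp), mul_comm]

lemma integral_mul_indicator_eq_sum (hO : MeasurableSet O) {h : Config N → ℝ} (hh : Integrable h)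
    (k : Fin N) :
    ∫ X, h X * O.indicator (fun _ => 1) (X k)
      = ∑ A, if k ∈ A then ∫ X in occupation O A, h X else 0 := by
  rw [sum_setIntegral_occupation hO hh (fun A => if k ∈ A then 1 else 0)]
  · simp
  · intro X A hX
    by_cases hk : k ∈ A
    · simp [hk, (hX k).2 hk]
    · have hk' : X k ∉ O := fun h => hk ((hX k).1 h)
      simp [hk, hk']

lemma integral_eq_sum_occupation (hO : MeasurableSet O) {h : Config N → ℝ} (hh : Integrable h) :
    ∫ X, h X = ∑ A, ∫ X in occupation O A, h X := by
  simpa using sum_setIntegral_occupation hO hh (fun _ => 1) (fun _ => 1) fun _ _ _ => rfl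

variable {f : Config N → ℂ} {G : Fin N → Config N → EuclideanSpace ℂ (Fin 3)}

lemma ofReal_setIntegral_g_sq {F : Type*} [NormedAddCommGroup F] {u : Config N → F}
    (hu : Integrable fun X => g X ^ 2 * ‖u X‖ ^ 2) (S : Set (Config N)) :
    ENNReal.ofReal (∫ X in S, g X ^ 2 * ‖u X‖ ^ 2) = ∫⁻ X in S, weight X * ‖u X‖ₑ ^ 2 := by
  rw [ofReal_integral_eq_lintegral_ofReal hu.integrableOn
    (Filter.Eventually.of_forall fun X => by positivity)]
  refine lintegral_congr fun X => ?_
  rw [ENNReal.ofReal_mul (by positivity), ENNReal.ofReal_pow (norm_nonneg _), ofReal_norm, weight]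

/-- The local exclusion principle for measurable functions and a convex region. -/
theorem localExclusion_of_measurable {q : ℕ} (hf : Measurable f) (hG : ∀ k, Measurable (G k))
    (hw : IsWeakGradient f G) (hanti : IsAntisymmetricInClasses q f)
    (hfi : Integrable fun X => g X ^ 2 * ‖f X‖ ^ 2)
    (hGi : ∀ k, Integrable fun X => g X ^ 2 * ‖G k X‖ ^ 2)
    (hO : MeasurableSet O) (hOc : Convex ℝ O)
    {L : ℝ} (hL : 0 < L) {c : Space} (hball : ball c (L / 2) ⊆ O)
    (hdiam : ∀ x ∈ O, ∀ y ∈ O, ‖x - y‖ ≤ 2 * L) :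
    (∑ k, ∫ X, g X ^ 2 * ‖f X‖ ^ 2 * O.indicator (fun _ => (1 : ℝ)) (X k))
        - q * ∫ X, g X ^ 2 * ‖f X‖ ^ 2
      ≤ 2 ^ 22 * L ^ 2 *
        ∑ k, ∫ X, g X ^ 2 * ‖G k X‖ ^ 2 * O.indicator (fun _ => (1 : ℝ)) (X k) := by
  obtain ⟨cl, hcl⟩ := hanti
  set F : Finset (Fin N) → ℝ := fun A => ∫ X in occupation O A, g X ^ 2 * ‖f X‖ ^ 2
  set E : Finset (Fin N) → Fin N → ℝ := fun A k =>
    ∫ X in occupation O A, g X ^ 2 * ‖G k X‖ ^ 2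
  have hF : ∀ A, 0 ≤ F A := fun A => integral_nonneg fun X => by positivity
  have hE : ∀ A k, 0 ≤ E A k := fun A k => integral_nonneg fun X => by positivity
  have hW := measurable_weight (N := N)
  have hpair : ∀ A, ∀ i ∈ A, ∀ j ∈ A, i ≠ j → cl i = cl j →
      F A ≤ 2 ^ 21 * L ^ 2 * (E A i + E A j) := by
    intro A i hi j hj hij hc
    have h := lintegral_occupation_le hf hG hw hij (hcl i j hij hc) hO hOc hL hball hdiam hi hj
    have hWG : Measurable fun X => weight X * ‖G i X‖ₑ ^ 2 := hW.mul ((hG i).enorm.pow_const 2)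
    have hsplit : ∫⁻ X in occupation O A, weight X * pairEnergy G i j X
        = ENNReal.ofReal (E A i) + ENNReal.ofReal (E A j) := by
      rw [ofReal_setIntegral_g_sq (hGi i), ofReal_setIntegral_g_sq (hGi j),
        ← lintegral_add_left hWG]
      exact lintegral_congr fun X => mul_add _ _ _
    rw [hsplit, ← ofReal_setIntegral_g_sq hfi, ← ENNReal.ofReal_add (hE A i) (hE A j),
      ← ENNReal.ofReal_mul (by positivity)] at h
    exact (ENNReal.ofReal_le_ofReal_iff
      (mul_nonneg (by positivity) (add_nonneg (hE A i) (hE A j)))).1 h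
  have hcomm : ∀ e : Finset (Fin N) → Fin N → ℝ,
      ∑ k, ∑ A, (if k ∈ A then e A k else 0) = ∑ A, ∑ k ∈ A, e A k := by
    intro e
    rw [Finset.sum_comm]
    exact Finset.sum_congr rfl fun A _ => by simp
  calc _ = ∑ A, ((A.card : ℝ) - q) * F A := by
        rw [Finset.sum_congr rfl fun k _ => integral_mul_indicator_eq_sum hO hfi k,
          hcomm fun A _ => F A, integral_eq_sum_occupation hO hfi, Finset.mul_sum,
          ← Finset.sum_sub_distrib]
        exact Finset.sum_congr rfl fun A _ => by
          rw [Finset.sum_const, nsmul_eq_mul, sub_mul]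
    _ ≤ ∑ A, 2 * (2 ^ 21 * L ^ 2) * ∑ k ∈ A, E A k :=
        Finset.sum_le_sum fun A _ =>
          card_sub_mul_le cl A (hF A) (by positivity) (hE A) (hpair A)
    _ = _ := by
        rw [Finset.sum_congr rfl fun k _ => integral_mul_indicator_eq_sum hO (hGi k) k, hcomm E, ← Finset.mul_sum]
        ring

end sum

/-! ### Measurable representatives -/

section representatives

variable {N : ℕ} {f f' : Config N → ℂ} {G G' : Fin N → Config N → EuclideanSpace ℂ (Fin 3)}

lemma IsWeakGradient.congr (h : IsWeakGradient f G) (hf : f =ᵐ[volume] f')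
    (hG : ∀ k, G k =ᵐ[volume] G' k) : IsWeakGradient f' G' := by
  obtain ⟨h1, h2, h3⟩ := h
  refine ⟨h1.congr hf, fun k => (h2 k).congr (hG k), fun i a φ hφ hφc => ?_⟩
  have e1 : ∫ X, (fderiv ℝ φ X (Pi.single i (EuclideanSpace.single a 1))) • f' X
      = ∫ X, (fderiv ℝ φ X (Pi.single i (EuclideanSpace.single a 1))) • f X :=
    integral_congr_ae (hf.mono fun X hX => by simp only [hX])
  have e2 : ∫ X, φ X • (G' i X) a = ∫ X, φ X • (G i X) a :=
    integral_congr_ae ((hG i).mono fun X hX => by simp only [hX])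
  rw [e1, e2, h3 i a φ hφ hφc]

lemma IsAntisymmetricInClasses.congr {q : ℕ} (h : IsAntisymmetricInClasses q f)
    (hf : f =ᵐ[volume] f') : IsAntisymmetricInClasses q f' := by
  obtain ⟨c, hc⟩ := h
  refine ⟨c, fun i j hij hcij => ?_⟩
  filter_upwards [hc i j hij hcij, hf,
    (measurePreserving_comp_perm (Equiv.swap i j)).quasiMeasurePreserving.ae hf] with X h1 h2 h3
  rw [← h2, ← h1, h3]

end representatives

/-! ### Cubes -/

/-- The open cube with edges of length `L` parallel to the coordinate axes and a vertex at `0`. -/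
def openBox (L : ℝ) : Set Space := {x | ∀ a, 0 < x a ∧ x a < L}

section cube

variable {L : ℝ}

lemma isOpen_openBox : IsOpen (openBox L) := by
  simp only [openBox, ofPred_forall, ofPred_and]
  refine isOpen_iInter_of_finite fun a => ?_
  exact (isOpen_lt continuous_const (by fun_prop)).inter (isOpen_lt (by fun_prop) continuous_const)

lemma convex_openBox : Convex ℝ (openBox L) := by
  have : openBox L = ⋂ a : Fin 3, (EuclideanSpace.proj a : Space →L[ℝ] ℝ) ⁻¹'
      Ioo 0 L := by
    ext x; simp [openBox]
  rw [this]
  exact convex_iInter fun a => (convex_Ioo 0 L).linear_preimage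
    (EuclideanSpace.proj a : Space →L[ℝ] ℝ).toLinearMap

/-- The centre of the cube `openBox L`. -/
noncomputable def boxCenter (L : ℝ) : Space := WithLp.toLp 2 fun _ => L / 2

lemma ball_subset_openBox : ball (boxCenter L) (L / 2) ⊆ openBox L := by
  intro x hx a
  have h1 := PiLp.norm_apply_le (x - boxCenter L) a
  rw [mem_ball_iff_norm] at hx
  have h2 : |x a - L / 2| < L / 2 := by
    simpa [boxCenter] using h1.trans_lt hx
  rw [abs_lt] at h2
  constructor <;> linarith

lemma norm_sub_le_of_mem_openBox {x y : Space} (hx : x ∈ openBox L) (hy : y ∈ openBox L) :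
    ‖x - y‖ ≤ 2 * L := by
  have hL : 0 < L := (hx 0).1.trans (hx 0).2
  rw [EuclideanSpace.norm_eq]
  refine Real.sqrt_le_iff.2 ⟨by positivity, ?_⟩
  have h : ∀ a, ‖(x - y) a‖ ^ 2 ≤ L ^ 2 := by
    intro a
    have h1 := hx a
    have h2 := hy a
    rw [PiLp.sub_apply, Real.norm_eq_abs, sq_abs]
    exact sq_le_sq' (by linarith) (by linarith)
  calc ∑ a, ‖(x - y) a‖ ^ 2 ≤ ∑ _ : Fin 3, L ^ 2 := Finset.sum_le_sum fun a _ => h a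
    _ ≤ (2 * L) ^ 2 := by simp; nlinarith

lemma closedBox_subset_closure (hL : 0 < L) :
    {x : Space | ∀ a, 0 ≤ x a ∧ x a ≤ L} ⊆ closure (openBox L) := by
  intro x hx
  have ht : Filter.Tendsto (fun t : ℝ => x + t • (boxCenter L - x)) (nhdsWithin 0 (Ioi 0))
      (nhds x) := by
    have : Continuous fun t : ℝ => x + t • (boxCenter L - x) := by fun_prop
    simpa using (this.tendsto 0).mono_left nhdsWithin_le_nhds
  refine mem_closure_of_tendsto ht ?_
  filter_upwards [Ioo_mem_nhdsGT (zero_lt_one (α := ℝ))] with t ht a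
  have h1 := hx a
  have h2 : (x + t • (boxCenter L - x)) a = x a + t * (L / 2 - x a) := by
    simp [boxCenter]
  rw [h2]
  constructor <;> nlinarith [ht.1, ht.2, mul_nonneg (sub_nonneg.2 ht.2.le) h1.1,
    mul_nonneg (sub_nonneg.2 ht.2.le) (sub_nonneg.2 h1.2), mul_pos ht.1 hL]

/-- Up to a null set, a cube is an open convex set of inradius at least `L / 2` and of diameter at
most `2 L`. -/
lemma IsCube.exists_convex {C : Set Space} (hC : IsCube C L) (hL : 0 < L) :
    ∃ (O : Set Space) (c : Space), IsOpen O ∧ Convex ℝ O ∧ ball c (L / 2) ⊆ O ∧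
      (∀ x ∈ O, ∀ y ∈ O, ‖x - y‖ ≤ 2 * L) ∧ C =ᵐ[volume] O := by
  obtain ⟨e, h1, h2⟩ := hC
  have hconv : Convex ℝ (e '' openBox L) := by
    have h := (convex_openBox (L := L)).affine_image
      e.toRealAffineIsometryEquiv.toAffineEquiv.toAffineMap
    simpa using h
  have hopen : IsOpen (e '' openBox L) := e.toHomeomorph.isOpenMap _ isOpen_openBox
  refine ⟨e '' openBox L, e (boxCenter L), hopen, hconv, ?_, ?_, ?_⟩
  · rw [← IsometryEquiv.image_ball]
    exact image_mono ball_subset_openBox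
  · rintro _ ⟨x, hx, rfl⟩ _ ⟨y, hy, rfl⟩
    rw [← dist_eq_norm, e.dist_eq, dist_eq_norm]
    exact norm_sub_le_of_mem_openBox hx hy
  · have hcl : C ⊆ closure (e '' openBox L) := by
      refine h2.trans ((image_mono (closedBox_subset_closure hL)).trans ?_)
      exact (e.toHomeomorph.image_closure _).subset
    refine Filter.EventuallyLE.antisymm ?_ (LE.le.eventuallyLE h1)
    rw [ae_le_set]
    refine measure_mono_null ?_ (hconv.addHaar_frontier volume)
    rw [hopen.frontier_eq]
    exact sdiff_subset_sdiff_left hcl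

end cube

/-! ### The one-particle density -/

section density

variable {N : ℕ}

/-- The separation of the `i`-th particle from the others. -/
noncomputable def insertAtEquiv (i : Fin N) :
    Space × ({j : Fin N // j ≠ i} → Space) ≃ᵐ Config N :=
  ((MeasurableEquiv.funUnique {j : Fin N // j = i} Space).symm.prodCongr
    (MeasurableEquiv.refl _)).trans
      (MeasurableEquiv.piEquivPiSubtypeProd (fun _ : Fin N => Space) fun j => j = i).symm

lemma insertAtEquiv_apply (i : Fin N) (p : Space × ({j : Fin N // j ≠ i} → Space)) :
    insertAtEquiv i p = insertAt i p.1 p.2 := rfl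

lemma measurePreserving_insertAtEquiv (i : Fin N) :
    MeasurePreserving (insertAtEquiv i) (volume.prod volume) volume := by
  have h1 := (volume_preserving_funUnique {j : Fin N // j = i} Space).symm
  have h2 : MeasurePreserving
      (MeasurableEquiv.piEquivPiSubtypeProd (fun _ : Fin N => Space) fun j => j = i).symm
      (volume.prod volume) volume :=
    by
      -- the two sides use different instances of `Fintype` on the subtypes
      convert (volume_preserving_piEquivPiSubtypeProd (fun _ : Fin N => Space) fun j => j = i).symm
      · rfl
      · rw [Measure.volume_eq_prod]
        congr!
  have h3 : MeasurePreserving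
      ((MeasurableEquiv.funUnique {j : Fin N // j = i} Space).symm.prodCongr
        (MeasurableEquiv.refl ({j : Fin N // j ≠ i} → Space)))
      (volume.prod volume) (volume.prod volume) := h1.prod (MeasurePreserving.id volume)
  exact h3.trans h2

variable {h : Config N → ℝ}

lemma integrable_insertAt (hh : Integrable h) (i : Fin N) :
    Integrable (fun p : Space × ({j : Fin N // j ≠ i} → Space) => h (insertAt i p.1 p.2))
      (volume.prod volume) :=
  ((measurePreserving_insertAtEquiv i).integrable_comp_emb
    (insertAtEquiv i).measurableEmbedding).2 hh

lemma setIntegral_integral_insertAt (hh : Integrable h) (i : Fin N) {O : Set Space}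
    (hO : MeasurableSet O) :
    ∫ x in O, ∫ Y : {j : Fin N // j ≠ i} → Space, h (insertAt i x Y)
      = ∫ X, h X * O.indicator (fun _ => (1 : ℝ)) (X i) := by
  have hp := (integrable_insertAt hh i).integrableOn (s := O ×ˢ univ)
  have h1 := setIntegral_prod _ hp
  rw [Measure.restrict_univ] at h1
  rw [← h1, ← integral_indicator (hO.prod MeasurableSet.univ),
    ← (measurePreserving_insertAtEquiv i).integral_comp (insertAtEquiv i).measurableEmbedding]
  refine integral_congr_ae (Filter.Eventually.of_forall fun p => ?_)
  have hpi : insertAt i p.1 p.2 i = p.1 := by simp [insertAt]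
  simp only [insertAtEquiv_apply, hpi]
  by_cases hx : p.1 ∈ O
  · rw [indicator_of_mem (show p ∈ O ×ˢ univ from ⟨hx, mem_univ _⟩), indicator_of_mem hx, mul_one]
  · rw [indicator_of_notMem (show p ∉ O ×ˢ univ from fun h' => hx h'.1), indicator_of_notMem hx, mul_zero]

variable {f : Config N → ℂ}

lemma integrable_density (hf : Integrable fun X => g X ^ 2 * ‖f X‖ ^ 2) :
    Integrable (density f) :=
  integrable_finsetSum _ fun i _ => (integrable_insertAt hf i).integral_prod_left

lemma setIntegral_density (hf : Integrable fun X => g X ^ 2 * ‖f X‖ ^ 2) {O : Set Space}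
    (hO : MeasurableSet O) :
    ∫ x in O, density f x
      = ∑ i, ∫ X, g X ^ 2 * ‖f X‖ ^ 2 * O.indicator (fun _ => (1 : ℝ)) (X i) := by
  simp only [density]
  rw [integral_finsetSum _ fun i _ => ((integrable_insertAt hf i).integral_prod_left).integrableOn]
  exact Finset.sum_congr rfl fun i _ => setIntegral_integral_insertAt hf i hO

end density

lemma integrable_g_sq_mul_norm_sq {N : ℕ} {F : Type*} [NormedAddCommGroup F]
    {u : Config N → F} (hu : MemLp u 2 (weightedMeasure N)) :
    Integrable fun X => g X ^ 2 * ‖u X‖ ^ 2 := by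
  have h1 := (memLp_two_iff_integrable_sq_norm hu.1).1 hu
  rw [show weightedMeasure N = volume.withDensity weight from rfl,
    integrable_withDensity_iff_integrable_smul' measurable_weight
    (Filter.Eventually.of_forall fun _ => ENNReal.ofReal_lt_top)] at h1
  refine h1.congr (Filter.Eventually.of_forall fun X => ?_)
  simp only [smul_eq_mul, weight]
  rw [ENNReal.toReal_ofReal (sq_nonneg _)]

lemma ae_indicator_apply_eq {N : ℕ} {C O : Set Space} (h : C =ᵐ[volume] O) (i : Fin N) :
    ∀ᵐ X : Config N, C.indicator (fun _ => (1 : ℝ)) (X i) = O.indicator (fun _ => (1 : ℝ)) (X i) :=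
  (Measure.quasiMeasurePreserving_eval _ i).ae (indicator_ae_eq_of_ae_eq_set h)

/-! ### The local exclusion principle -/

/-- The local exclusion principle with the constant `2⁻²²`. -/
theorem localExclusion {N q : ℕ} {f : Config N → ℂ}
    {G : Fin N → Config N → EuclideanSpace ℂ (Fin 3)} (hfG : IsH1WithGradient f G)
    (hanti : IsAntisymmetricInClasses q f) (hnorm : ∫ X, g X ^ 2 * ‖f X‖ ^ 2 = 1)
    {L : ℝ} (hL : 0 < L) {C : Set Space} (hC : IsCube C L) :
    Integrable (density f) ∧
      (2 ^ 22)⁻¹ / L ^ 2 * ((∫ x in C, density f x) - (q : ℝ)) ≤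
        ∑ i, ∫ X, g X ^ 2 * ‖G i X‖ ^ 2 * C.indicator (fun _ => (1 : ℝ)) (X i) := by
  have hfi := integrable_g_sq_mul_norm_sq hfG.memLp
  have hGi := fun k => integrable_g_sq_mul_norm_sq (hfG.memLp_gradient k)
  refine ⟨integrable_density hfi, ?_⟩
  obtain ⟨O, c, hOo, hOc, hball, hdiam, hCO⟩ := hC.exists_convex hL
  -- measurable representatives of `f` and of its gradient
  have hfm := hfG.isWeakGradient.1.aestronglyMeasurable
  have hGm := fun k => (hfG.isWeakGradient.2.1 k).aestronglyMeasurable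
  set f' := hfm.mk f
  set G' := fun k => (hGm k).mk (G k)
  have hff' : f =ᵐ[volume] f' := hfm.ae_eq_mk
  have hGG' : ∀ k, G k =ᵐ[volume] G' k := fun k => (hGm k).ae_eq_mk
  have hfe : (fun X => g X ^ 2 * ‖f X‖ ^ 2) =ᵐ[volume] fun X => g X ^ 2 * ‖f' X‖ ^ 2 :=
    hff'.mono fun X hX => by simp only [hX]
  have hGe : ∀ k, (fun X => g X ^ 2 * ‖G k X‖ ^ 2) =ᵐ[volume] fun X => g X ^ 2 * ‖G' k X‖ ^ 2 :=
    fun k => (hGG' k).mono fun X hX => by simp only [hX]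
  have key := localExclusion_of_measurable (O := O)
    hfm.stronglyMeasurable_mk.measurable (fun k => (hGm k).stronglyMeasurable_mk.measurable)
    (hfG.isWeakGradient.congr hff' hGG') (hanti.congr hff') (hfi.congr hfe)
    (fun k => (hGi k).congr (hGe k)) hOo.measurableSet hOc hL hball hdiam
  have e1 : ∀ k, ∫ X, g X ^ 2 * ‖f' X‖ ^ 2 * O.indicator (fun _ => (1 : ℝ)) (X k)
      = ∫ X, g X ^ 2 * ‖f X‖ ^ 2 * O.indicator (fun _ => (1 : ℝ)) (X k) := fun k =>
    integral_congr_ae (hff'.mono fun X hX => by simp only [hX])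
  have e2 : ∀ k, ∫ X, g X ^ 2 * ‖G' k X‖ ^ 2 * O.indicator (fun _ => (1 : ℝ)) (X k)
      = ∫ X, g X ^ 2 * ‖G k X‖ ^ 2 * C.indicator (fun _ => (1 : ℝ)) (X k) := fun k => by
    refine integral_congr_ae ?_
    filter_upwards [hGG' k, ae_indicator_apply_eq hCO k] with X h1 h2
    rw [h1, h2]
  rw [Finset.sum_congr rfl fun k _ => e1 k, Finset.sum_congr rfl fun k _ => e2 k,
    ← setIntegral_density hfi hOo.measurableSet, ← integral_congr_ae hfe, hnorm, mul_one,
    ← setIntegral_congr_set hCO] at key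
  rw [div_mul_eq_mul_div, div_le_iff₀ (by positivity), inv_mul_le_iff₀ (by positivity)]
  linarith

end PointInteraction

theorem mainTheorem2 :
    ∃ k : ℝ, 0 < k ∧
      ∀ (N : ℕ), 2 ≤ N → ∀ (q : ℕ)
        (f : PointInteraction.Config N → ℂ)
        (G : Fin N → PointInteraction.Config N → EuclideanSpace ℂ (Fin 3)),
        PointInteraction.IsH1WithGradient f G →
        PointInteraction.IsAntisymmetricInClasses q f →
        (∫ X : PointInteraction.Config N, PointInteraction.g X ^ 2 * ‖f X‖ ^ 2) = 1 →
        ∀ (L : ℝ), 0 < L → ∀ (C : Set PointInteraction.Space), PointInteraction.IsCube C L →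
          Integrable (PointInteraction.density f) volume ∧
          k / L ^ 2 * ((∫ x in C, PointInteraction.density f x) - (q : ℝ)) ≤
            ∑ i : Fin N, ∫ X : PointInteraction.Config N,
              PointInteraction.g X ^ 2 * ‖G i X‖ ^ 2 *
                C.indicator (fun _ => (1 : ℝ)) (X i) := by
  exact ⟨(2 ^ 22)⁻¹, by positivity, fun _ _ _ _ _ hfG hanti hnorm _ hL _ hC =>
    PointInteraction.localExclusion hfG hanti hnorm hL hC⟩
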